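/- Let $\mathbb F\in\{\mathbb R,\mathbb C\}$, let $1\le p<\infty$, and let $\mathbf w=(w_n)_{n=1}^\infty$ be a weight in the class $\mathcal W$, i.e. a nonincreasing sequence of positive real numbers with $w_1=1$, $\lim_n w_n=0$ and $\sum_n w_n=\infty$. Let $\mathcal O$ be the set of (strictly) increasing maps $\mathbb N\to\mathbb N$ and $\Pi$ the set of permutations of $\mathbb N$. The Garling sequence space $g(\mathbf w,p)$ and the Lorentz sequence space $d(\mathbf w,p)$ are the spaces of all $f=(a_n)_{n=1}^\infty\in\mathbb F^{\mathbb N}$ for which, respectively, $$\|f\|_{g}=\sup_{\phi\in\mathcal O}\Big(\sum_{n=1}^\infty |a_{\phi(n)}|^p w_n\Big)^{1/p}<\infty,\qquad \|f\|_{d}=\sup_{\sigma\in\Pi}\Big(\sum_{n=1}^\infty |a_{\sigma(n)}|^p w_n\Big)^{1/p}<\infty .$$ Let $(\mathbf e_n)_{n=1}^\infty$ be the unit vectors. Sequences $(x_n)$ and $(y_n)$ in normed spaces are called equivalent if there is $C>0$ with $C^{-1}\|\sum_n a_ny_n\|\le\|\sum_n a_nx_n\|\le C\|\sum_n a_ny_n\|$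 for all finitely supported scalar sequences $(a_n)$. A basic sequence is a sequence that is a Schauder basis of its closed linear span. For $C\ge 1$, two normed spaces are $C$-isomorphic if there is an isomorphism $T$ of one onto the other with $\|T\|\,\|T^{-1}\|\le C$, and a subspace $Z$ of $X$ is $C$-complemented in $X$ if there is a bounded projection of $X$ onto $Z$ with norm at most $C$. Then: (i) The closed linear span of the unit vectors is all of $g(\mathbf w,p)$, and they form a boundedly complete Schauder basis of $g(\mathbf w,p)$: if the partial sums of $\sum_n a_n\mathbf e_n$ are bounded, then the series converges. (ii) Every basic sequence in $g(\mathbf w,p)$ that is equivalent to the unit vector basis of $g(\mathbf w,p)$ has a subsequence whose closed linear span is complemented in $g(\mathbf w,p)$. (iii) If $1<p<\infty$ then $g(\mathbf w,p)$ is reflexive, while $g(\mathbf w,1)$ is not reflexive. (iv) No subspace of $\ell_p$ is isomorphic to $g(\mathbf w,p)$. (v) For every $\varepsilon>0$ and every infinite-dimensional closed subspace $Y$ of $g(\mathbf w,p)$ there is a closed subspace $Z\subseteq Y$ that is $(1+\varepsilon)$-isomorphic to $\ell_p$ and $(1+\varepsilon)$-complemented in $g(\mathbf w,p)$. (vi)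 $d(\mathbf w,p)\subseteq g(\mathbf w,p)$ with bounded inclusion map $I_{d,g}$, and the identity operator on $\ell_p$ factors through $I_{d,g}$: there are bounded linear operators $T\colon\ell_p\to d(\mathbf w,p)$ and $S\colon g(\mathbf w,p)\to\ell_p$ with $S\circ I_{d,g}\circ T=\mathrm{Id}_{\ell_p}$. -/

import Mathlib

open Filter Topology
open scoped NNReal ENNReal

noncomputable section

namespace GarlingSpaces

/-- The class `𝒲` of weights: nonincreasing sequences of positive reals, normalized by
`w 0 = 1`, tending to `0` and not summable (sequences are indexed from `0`). -/
structure Weight where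
  toFun : ℕ → ℝ
  zero_eq_one : toFun 0 = 1
  antitone : Antitone toFun
  pos : ∀ n, 0 < toFun n
  tendsto_zero : Tendsto toFun atTop (𝓝 0)
  not_summable : ¬ Summable toFun

instance : CoeFun Weight (fun _ => ℕ → ℝ) := ⟨Weight.toFun⟩

/-- The set `𝒪` of (strictly) increasing maps `ℕ → ℕ`. -/
def increasingMaps : Set (ℕ → ℕ) := {φ | StrictMono φ}

/-- The set `Π` of permutations of `ℕ`. -/
def permutationMaps : Set (ℕ → ℕ) := {σ | Function.Bijective σ}

/-- `sup_{φ ∈ Φ} (∑ₙ |a_{φ(n)}|^p wₙ)^{1/p}`, as an extended nonnegative real.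
For `Φ = increasingMaps` this is the Garling norm, for `Φ = permutationMaps` the Lorentz norm. -/
def supENorm {𝕜 : Type*} [RCLike 𝕜] (Φ : Set (ℕ → ℕ)) (w : Weight) (p : ℝ≥0) (a : ℕ → 𝕜) :
    ℝ≥0∞ :=
  ⨆ φ ∈ Φ, (∑' n, ‖a (φ n)‖ₑ ^ (p : ℝ) * ENNReal.ofReal (w n)) ^ (1 / (p : ℝ))

/-- What is needed of a family of maps for `supENorm` to be a norm for which the
unit vectors have finite norm. -/
class IsAdmissible (Φ : Set (ℕ → ℕ)) : Prop where
  injective : ∀ φ ∈ Φ, Function.Injective φ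
  exists_zero : ∀ i, ∃ φ ∈ Φ, φ 0 = i

instance : IsAdmissible increasingMaps where
  injective _ h := StrictMono.injective h
  exists_zero i := ⟨fun n => n + i, fun a b h => by simpa using h, by simp⟩

instance : IsAdmissible permutationMaps where
  injective _ h := h.1
  exists_zero i := ⟨Equiv.swap 0 i, (Equiv.swap 0 i).bijective, by simp⟩

section norm

variable {𝕜 : Type*} [RCLike 𝕜] (Φ : Set (ℕ → ℕ)) (w : Weight) (p : ℝ≥0)

theorem supENorm_zero (hp : 1 ≤ p) : supENorm Φ w p (0 : ℕ → 𝕜) = 0 := by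
  have h0 : (0 : ℝ) < p := by exact_mod_cast lt_of_lt_of_le one_pos hp
  simp [supENorm, ENNReal.zero_rpow_of_pos h0, h0]

theorem supENorm_smul (hp : 1 ≤ p) (c : 𝕜) (a : ℕ → 𝕜) :
    supENorm Φ w p (c • a) = ‖c‖ₑ * supENorm Φ w p a := by
  have h0 : (0 : ℝ) < p := by exact_mod_cast lt_of_lt_of_le one_pos hp
  simp only [supENorm, ENNReal.mul_iSup]
  refine iSup_congr fun φ => iSup_congr fun _ => ?_
  have : ∀ n, ‖(c • a) (φ n)‖ₑ ^ (p : ℝ) * ENNReal.ofReal (w n)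
      = ‖c‖ₑ ^ (p : ℝ) * (‖a (φ n)‖ₑ ^ (p : ℝ) * ENNReal.ofReal (w n)) := by
    intro n
    rw [Pi.smul_apply, smul_eq_mul, enorm_mul, ENNReal.mul_rpow_of_nonneg _ _ h0.le, mul_assoc]
  simp_rw [this]
  rw [ENNReal.tsum_mul_left, ENNReal.mul_rpow_of_nonneg _ _ (by positivity), ← ENNReal.rpow_mul,
    mul_one_div_cancel h0.ne', ENNReal.rpow_one]

theorem supENorm_add_le (hp : 1 ≤ p) (a b : ℕ → 𝕜) :
    supENorm Φ w p (a + b) ≤ supENorm Φ w p a + supENorm Φ w p b := by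
  have h1 : (1 : ℝ) ≤ p := by exact_mod_cast hp
  have h0 : (0 : ℝ) < p := by linarith
  refine iSup₂_le fun φ hφ => ?_
  have key : ∀ c : ℕ → 𝕜, (∑' n, ‖c (φ n)‖ₑ ^ (p : ℝ) * ENNReal.ofReal (w n))
      = ∫⁻ n, (‖c (φ n)‖ₑ * ENNReal.ofReal (w n) ^ (1 / (p : ℝ))) ^ (p : ℝ)
        ∂MeasureTheory.Measure.count := by
    intro c
    rw [MeasureTheory.lintegral_count]
    refine tsum_congr fun n => ?_
    rw [ENNReal.mul_rpow_of_nonneg _ _ h0.le, ← ENNReal.rpow_mul, one_div_mul_cancel h0.ne',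
      ENNReal.rpow_one]
  have hle : ∀ c : ℕ → 𝕜,
      (∑' n, ‖c (φ n)‖ₑ ^ (p : ℝ) * ENNReal.ofReal (w n)) ^ (1 / (p : ℝ)) ≤ supENorm Φ w p c :=
    fun c => le_iSup₂ (f := fun φ (_ : φ ∈ Φ) =>
      (∑' n, ‖c (φ n)‖ₑ ^ (p : ℝ) * ENNReal.ofReal (w n)) ^ (1 / (p : ℝ))) φ hφ
  refine le_trans ?_ (add_le_add (hle a) (hle b))
  rw [key, key, key]
  refine le_trans ?_ (ENNReal.lintegral_Lp_add_le (μ := MeasureTheory.Measure.count)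
    (measurable_of_countable _).aemeasurable (measurable_of_countable _).aemeasurable h1)
  refine ENNReal.rpow_le_rpow (MeasureTheory.lintegral_mono fun n => ?_) (by positivity)
  refine ENNReal.rpow_le_rpow ?_ h0.le
  rw [Pi.add_apply, Pi.add_apply, ← add_mul]
  gcongr
  exact enorm_add_le _ _

theorem enorm_apply_le_supENorm [IsAdmissible Φ] (hp : 1 ≤ p) (a : ℕ → 𝕜) (i : ℕ) :
    ‖a i‖ₑ ≤ supENorm Φ w p a := by
  have h0 : (0 : ℝ) < p := by exact_mod_cast lt_of_lt_of_le one_pos hp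
  obtain ⟨φ, hφ, rfl⟩ := IsAdmissible.exists_zero (Φ := Φ) i
  refine le_trans ?_ (le_iSup₂ (f := fun φ (_ : φ ∈ Φ) =>
      (∑' n, ‖a (φ n)‖ₑ ^ (p : ℝ) * ENNReal.ofReal (w n)) ^ (1 / (p : ℝ))) φ hφ)
  calc ‖a (φ 0)‖ₑ = (‖a (φ 0)‖ₑ ^ (p : ℝ) * ENNReal.ofReal (w 0)) ^ (1 / (p : ℝ)) := by
        rw [w.zero_eq_one, ENNReal.ofReal_one, mul_one, ← ENNReal.rpow_mul,
          mul_one_div_cancel h0.ne', ENNReal.rpow_one]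
    _ ≤ _ := ENNReal.rpow_le_rpow
        (ENNReal.le_tsum (f := fun n => ‖a (φ n)‖ₑ ^ (p : ℝ) * ENNReal.ofReal (w n)) 0)
        (by positivity)

theorem supENorm_single_lt_top [IsAdmissible Φ] (hp : 1 ≤ p) (i : ℕ) :
    supENorm Φ w p (Pi.single i (1 : 𝕜)) < ∞ := by
  have h0 : (0 : ℝ) < p := by exact_mod_cast lt_of_lt_of_le one_pos hp
  refine lt_of_le_of_lt (iSup₂_le fun φ hφ => ?_) ENNReal.one_lt_top
  have hinj := IsAdmissible.injective (Φ := Φ) φ hφ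
  refine ENNReal.rpow_le_one ?_ (by positivity)
  by_cases h : ∃ n, φ n = i
  · obtain ⟨n, rfl⟩ := h
    rw [tsum_eq_single n]
    · simpa [w.zero_eq_one] using w.antitone (Nat.zero_le n)
    · intro m hm
      simp [hinj.eq_iff, hm, h0]
  · push Not at h
    simp [h, h0]

end norm

/-- The linear space of all scalar sequences with finite `supENorm`. -/
def finiteSubmodule (𝕜 : Type*) [RCLike 𝕜] (Φ : Set (ℕ → ℕ)) (w : Weight) (p : ℝ≥0)
    [hp : Fact (1 ≤ p)] : Submodule 𝕜 (ℕ → 𝕜) where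
  carrier := {a | supENorm Φ w p a < ∞}
  add_mem' ha hb := (supENorm_add_le Φ w p hp.out _ _).trans_lt (ENNReal.add_lt_top.2 ⟨ha, hb⟩)
  zero_mem' := by simp [supENorm_zero Φ w p hp.out]
  smul_mem' c a ha := by
    simpa [supENorm_smul Φ w p hp.out] using ENNReal.mul_lt_top enorm_lt_top ha

/-- The space of all scalar sequences with finite `supENorm`, normed by `supENorm`.  (A type
synonym of `finiteSubmodule`, so that it does not carry the topology of pointwise convergence.) -/
def SupSpace (𝕜 : Type*) [RCLike 𝕜] (Φ : Set (ℕ → ℕ)) (w : Weight) (p : ℝ≥0)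
    [Fact (1 ≤ p)] : Type _ :=
  finiteSubmodule 𝕜 Φ w p

namespace SupSpace

variable {𝕜 : Type*} [RCLike 𝕜] {Φ : Set (ℕ → ℕ)} {w : Weight} {p : ℝ≥0} [hp : Fact (1 ≤ p)]

instance : AddCommGroup (SupSpace 𝕜 Φ w p) :=
  inferInstanceAs (AddCommGroup (finiteSubmodule 𝕜 Φ w p))

instance : Module 𝕜 (SupSpace 𝕜 Φ w p) :=
  inferInstanceAs (Module 𝕜 (finiteSubmodule 𝕜 Φ w p))

/-- The inclusion of the space into the space of all sequences. -/
def toSeq : SupSpace 𝕜 Φ w p →ₗ[𝕜] (ℕ → 𝕜) := (finiteSubmodule 𝕜 Φ w p).subtype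

/-- An element of the space, from a sequence with finite norm. -/
def mk (a : ℕ → 𝕜) (ha : supENorm Φ w p a < ∞) : SupSpace 𝕜 Φ w p := ⟨a, ha⟩

instance : Norm (SupSpace 𝕜 Φ w p) := ⟨fun f => (supENorm Φ w p (toSeq f)).toReal⟩

theorem norm_def (f : SupSpace 𝕜 Φ w p) : ‖f‖ = (supENorm Φ w p (toSeq f)).toReal := rfl

theorem supENorm_lt_top (f : SupSpace 𝕜 Φ w p) : supENorm Φ w p (toSeq f) < ∞ := f.2

theorem toSeq_injective : Function.Injective (toSeq : SupSpace 𝕜 Φ w p → ℕ → 𝕜) :=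
  Subtype.val_injective

theorem normedSpaceCore [IsAdmissible Φ] : NormedSpace.Core 𝕜 (SupSpace 𝕜 Φ w p) where
  norm_nonneg _ := ENNReal.toReal_nonneg
  norm_smul c f := by
    rw [norm_def, norm_def, map_smul, supENorm_smul Φ w p hp.out, ENNReal.toReal_mul, toReal_enorm]
  norm_triangle f g := by
    rw [norm_def, norm_def, norm_def, map_add,
      ← ENNReal.toReal_add (supENorm_lt_top f).ne (supENorm_lt_top g).ne]
    exact ENNReal.toReal_mono (ENNReal.add_lt_top.2 ⟨supENorm_lt_top f, supENorm_lt_top g⟩).ne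
      (supENorm_add_le Φ w p hp.out _ _)
  norm_eq_zero_iff f := by
    rw [norm_def, ENNReal.toReal_eq_zero_iff, or_iff_left (supENorm_lt_top f).ne]
    constructor
    · intro h
      refine toSeq_injective (funext fun i => ?_)
      have := enorm_apply_le_supENorm Φ w p hp.out (toSeq f) i
      rw [h] at this
      simpa using this
    · rintro rfl
      rw [map_zero, supENorm_zero Φ w p hp.out]

instance [IsAdmissible Φ] : NormedAddCommGroup (SupSpace 𝕜 Φ w p) :=
  NormedAddCommGroup.ofCore normedSpaceCore

instance [IsAdmissible Φ] : NormedSpace 𝕜 (SupSpace 𝕜 Φ w p) :=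
  NormedSpace.ofCore normedSpaceCore

/-- The canonical unit vectors. -/
def unitVector (𝕜 : Type*) [RCLike 𝕜] (Φ : Set (ℕ → ℕ)) [IsAdmissible Φ] (w : Weight) (p : ℝ≥0)
    [hp : Fact (1 ≤ p)] (n : ℕ) : SupSpace 𝕜 Φ w p :=
  mk (Pi.single n 1) (supENorm_single_lt_top Φ w p hp.out n)

end SupSpace

/-- The Garling sequence space `g(w,p)`. -/
abbrev Garling (𝕜 : Type*) [RCLike 𝕜] (w : Weight) (p : ℝ≥0) [Fact (1 ≤ p)] : Type _ :=
  SupSpace 𝕜 increasingMaps w p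

/-- The Lorentz sequence space `d(w,p)`. -/
abbrev Lorentz (𝕜 : Type*) [RCLike 𝕜] (w : Weight) (p : ℝ≥0) [Fact (1 ≤ p)] : Type _ :=
  SupSpace 𝕜 permutationMaps w p

/-- The canonical unit vector basis of `g(w,p)`. -/
abbrev garlingUnit (𝕜 : Type*) [RCLike 𝕜] (w : Weight) (p : ℝ≥0) [Fact (1 ≤ p)] :
    ℕ → Garling 𝕜 w p :=
  SupSpace.unitVector 𝕜 increasingMaps w p

instance fact_one_le_coe (p : ℝ≥0) [hp : Fact (1 ≤ p)] : Fact (1 ≤ (p : ℝ≥0∞)) :=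
  ⟨by exact_mod_cast hp.out⟩

/-- The sequence space `ℓ_p`, for finite `p`. -/
abbrev EllP (𝕜 : Type*) [RCLike 𝕜] (p : ℝ≥0) : Type _ := lp (fun _ : ℕ => 𝕜) (p : ℝ≥0∞)

theorem supENorm_increasing_le_permutation {𝕜 : Type*} [RCLike 𝕜] (w : Weight) (p : ℝ≥0)
    (a : ℕ → 𝕜) : supENorm increasingMaps w p a ≤ supENorm permutationMaps w p a := by
  refine iSup₂_le fun φ hφ => ?_
  have hφ' : StrictMono φ := hφ
  by_cases hp : p = 0
  · subst hp
    exact le_trans (by simp) (le_iSup₂ (f := fun σ (_ : σ ∈ permutationMaps) =>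
      (∑' n, ‖a (σ n)‖ₑ ^ ((0 : ℝ≥0) : ℝ) * ENNReal.ofReal (w n)) ^ (1 / ((0 : ℝ≥0) : ℝ)))
      id Function.bijective_id)
  have h0 : (0 : ℝ) < p := by exact_mod_cast pos_iff_ne_zero.2 hp
  rw [one_div, ENNReal.rpow_inv_le_iff h0, ENNReal.tsum_eq_iSup_nat]
  refine iSup_le fun N => ?_
  obtain ⟨σ, hσ⟩ := (Equiv.Perm.isMultiplyPretransitive ℕ N).exists_smul_eq
    ⟨fun i : Fin N => (i : ℕ), Fin.val_injective⟩
    ⟨fun i : Fin N => φ i, hφ'.injective.comp Fin.val_injective⟩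
  have hσ' : ∀ n < N, σ n = φ n := fun n hn => DFunLike.congr_fun hσ (⟨n, hn⟩ : Fin N)
  rw [← ENNReal.rpow_inv_le_iff h0, ← one_div]
  refine le_trans (ENNReal.rpow_le_rpow ?_ (by positivity))
    (le_iSup₂ (f := fun σ (_ : σ ∈ permutationMaps) =>
      (∑' n, ‖a (σ n)‖ₑ ^ (p : ℝ) * ENNReal.ofReal (w n)) ^ (1 / (p : ℝ))) σ σ.bijective)
  refine le_trans (le_of_eq ?_) (ENNReal.sum_le_tsum (Finset.range N))
  refine Finset.sum_congr rfl fun n hn => ?_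
  rw [hσ' n (Finset.mem_range.1 hn)]

/-- The inclusion map `I_{d,g} : d(w,p) → g(w,p)`, which sends a sequence to itself. -/
def lorentzInclusion (𝕜 : Type*) [RCLike 𝕜] (w : Weight) (p : ℝ≥0) [Fact (1 ≤ p)] :
    Lorentz 𝕜 w p →L[𝕜] Garling 𝕜 w p :=
  LinearMap.mkContinuous
    { toFun := fun f => SupSpace.mk (SupSpace.toSeq f)
        ((supENorm_increasing_le_permutation w p _).trans_lt (SupSpace.supENorm_lt_top f))
      map_add' := fun _ _ => rfl
      map_smul' := fun _ _ => rfl } 1 fun f => by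
    rw [one_mul]
    exact ENNReal.toReal_mono (SupSpace.supENorm_lt_top f).ne
      (supENorm_increasing_le_permutation w p _)

section BanachSpace

variable (𝕜 : Type*) [RCLike 𝕜] {X Y : Type*} [NormedAddCommGroup X] [NormedSpace 𝕜 X]
  [NormedAddCommGroup Y] [NormedSpace 𝕜 Y]

/-- The closed linear span of a sequence. -/
def closedSpan (x : ℕ → X) : Submodule 𝕜 X := (Submodule.span 𝕜 (Set.range x)).topologicalClosure

/-- `x` is a Schauder basis of the whole space `X`. -/
def IsSchauderBasis (x : ℕ → X) : Prop := ∃ b : SchauderBasis 𝕜 X, ∀ n, b n = x n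

/-- `x` is a Schauder basis of its closed linear span. -/
def IsBasicSequence (x : ℕ → X) : Prop :=
  ∃ b : SchauderBasis 𝕜 (closedSpan 𝕜 x), ∀ n, (b n : X) = x n

/-- A series `∑ aₙ xₙ` converges whenever its partial sums are bounded. -/
def IsBoundedlyComplete (x : ℕ → X) : Prop :=
  ∀ a : ℕ → 𝕜, (∃ C : ℝ, ∀ n, ‖∑ i ∈ Finset.range n, a i • x i‖ ≤ C) →
    ∃ f : X, Tendsto (fun n => ∑ i ∈ Finset.range n, a i • x i) atTop (𝓝 f)

/-- `y` dominates `x`. -/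
def Dominates (y : ℕ → Y) (x : ℕ → X) : Prop :=
  ∃ C : ℝ, 0 < C ∧ ∀ a : ℕ →₀ 𝕜,
    ‖a.sum fun n c => c • x n‖ ≤ C * ‖a.sum fun n c => c • y n‖

/-- Equivalence of (basic) sequences: each dominates the other. -/
def AreEquivalent (x : ℕ → X) (y : ℕ → Y) : Prop := Dominates 𝕜 y x ∧ Dominates 𝕜 x y

variable (X) in
/-- The canonical map into the bidual is onto. -/
def IsReflexive : Prop := Function.Surjective (NormedSpace.inclusionInDoubleDual 𝕜 X)

variable (X Y) in
/-- `X` and `Y` are `C`-isomorphic. -/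
def IsIsomorphicWith (C : ℝ) : Prop :=
  ∃ T : X ≃L[𝕜] Y, ‖(T : X →L[𝕜] Y)‖ * ‖(T.symm : Y →L[𝕜] X)‖ ≤ C

variable {𝕜} in
/-- The subspace `Z` of `X` is `C`-complemented: it is the range of a projection of norm at
most `C`. -/
def IsComplementedWith (C : ℝ) (Z : Submodule 𝕜 X) : Prop :=
  ∃ P : X →L[𝕜] Z, (∀ z : Z, P z = z) ∧ ‖P‖ ≤ C

end BanachSpace

end GarlingSpaces

end

open GarlingSpaces

open Filter Topology
open scoped NNReal ENNReal

noncomputable section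

namespace GarlingSpaces

/-! Two features of the norm carry everything. For one fixed map `φ` the sum of `|a (φ n)|^p w n` is
additive over disjointly supported vectors, which gives an upper `p`-estimate. And since `w` is
nonincreasing, moving an entry to an earlier weight only helps, so pieces of increasing maps living
on successive sets of weight indices can be glued, with gaps, into one competitor for the supremum
(`sum_le_norm_rpow`).

Basis: non-summability of `w` makes coordinates null, and if the tails did not vanish, two almost
optimal maps glued together would exceed the norm (`tendsto_tail`). Bounded completeness is the
Fatou property of a supremum of finite sums.

Copies of `ℓ_p`: when the coordinates of normalized vectors tend uniformly to `0`, finitely many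
coordinates or weight indices contribute almost nothing. A gliding hump therefore gives vectors
whose norms are nearly attained on disjoint intervals of coordinates and of weight indices. The
upper `p`-estimate yields an operator from `ℓ_p`; the norming functionals of the humps, controlled
by Jensen and by gluing, yield an almost inverse (`exists_ellP_factorization`). Every
infinite-dimensional subspace has vectors with uniformly small coordinates (`exists_small_sup`),
whence (v). Flat blocks are normalized in both `d(w,p)` and `g(w,p)`, whence (vi).

Reflexivity for `1 < p` follows from the basis being shrinking (upper `p`-estimate) and boundedly
complete; for `p = 1` the complemented copy of `ℓ_1` forbids it. For (iv), sums of `m` unit vectors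
have `p`-th power of the norm at most `w 0 + ... + w (m-1) = o(m)`, whereas weakly null
seminormalized sequences in `ℓ_p` have sums of order `m`.

For (ii), either the sequence has members with uniformly small coordinates, and a subsequence spans
a complemented `ℓ_p`, or each late vector has a large coordinate. Reading off those coordinates
along a sparse subsequence almost inverts the map from the unit vectors to that subsequence
(`exists_complemented_of_large`). -/

theorem Weight.sum_range_tendsto (w : Weight) :
    Tendsto (fun n => ∑ i ∈ Finset.range n, w i) atTop atTop :=
  (not_summable_iff_tendsto_nat_atTop_of_nonneg fun n => (w.pos n).le).1 w.not_summable

/-- Cesàro means of a null sequence are null. This `o(n)` growth is what distinguishes the unit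
vectors of `g(w,p)` from those of `ℓ_p`. -/
theorem Weight.sum_range_div_tendsto (w : Weight) :
    Tendsto (fun n : ℕ => (∑ i ∈ Finset.range n, w i) / n) atTop (𝓝 0) := by
  have := w.tendsto_zero.cesaro
  refine this.congr fun n => ?_
  rw [div_eq_inv_mul]

/-! ### The `p`-th power of the norm: Fatou property and upper `p`-estimate -/

section supPow

variable {𝕜 : Type*} [RCLike 𝕜] {Φ : Set (ℕ → ℕ)} {w : Weight} {p : ℝ≥0}

/-- The `p`-th power of `supENorm`. -/
def supPow (Φ : Set (ℕ → ℕ)) (w : Weight) (p : ℝ≥0) (a : ℕ → 𝕜) : ℝ≥0∞ :=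
  ⨆ φ ∈ Φ, ∑' n, ‖a (φ n)‖ₑ ^ (p : ℝ) * ENNReal.ofReal (w n)

theorem tsum_le_supPow (a : ℕ → 𝕜) {φ : ℕ → ℕ} (hφ : φ ∈ Φ) :
    ∑' n, ‖a (φ n)‖ₑ ^ (p : ℝ) * ENNReal.ofReal (w n) ≤ supPow Φ w p a :=
  le_iSup₂ (f := fun φ (_ : φ ∈ Φ) => ∑' n, ‖a (φ n)‖ₑ ^ (p : ℝ) * ENNReal.ofReal (w n)) φ hφ

theorem supPow_le_iff {a : ℕ → 𝕜} {C : ℝ≥0∞} :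
    supPow Φ w p a ≤ C ↔ ∀ φ ∈ Φ, ∀ N,
      ∑ n ∈ Finset.range N, ‖a (φ n)‖ₑ ^ (p : ℝ) * ENNReal.ofReal (w n) ≤ C := by
  simp only [supPow, iSup_le_iff, ENNReal.tsum_eq_iSup_nat]

theorem supENorm_rpow (hp : 1 ≤ p) (a : ℕ → 𝕜) :
    supENorm Φ w p a ^ (p : ℝ) = supPow Φ w p a := by
  have h0 : (0 : ℝ) < p := by exact_mod_cast lt_of_lt_of_le one_pos hp
  refine le_antisymm ?_ ?_
  · rw [← ENNReal.le_rpow_inv_iff h0, ← one_div]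
    exact iSup₂_le fun φ hφ => ENNReal.rpow_le_rpow (tsum_le_supPow a hφ) (by positivity)
  · refine iSup₂_le fun φ hφ => ?_
    rw [← ENNReal.rpow_inv_le_iff h0, ← one_div]
    exact le_iSup₂ (f := fun φ (_ : φ ∈ Φ) =>
      (∑' n, ‖a (φ n)‖ₑ ^ (p : ℝ) * ENNReal.ofReal (w n)) ^ (1 / (p : ℝ))) φ hφ

theorem supENorm_lt_top_iff (hp : 1 ≤ p) (a : ℕ → 𝕜) :
    supENorm Φ w p a < ∞ ↔ supPow Φ w p a < ∞ := by
  have h0 : (0 : ℝ) < p := by exact_mod_cast lt_of_lt_of_le one_pos hp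
  rw [← supENorm_rpow hp, ENNReal.rpow_lt_top_iff_of_pos h0]

theorem supPow_mono {a b : ℕ → 𝕜} (h : ∀ i, ‖a i‖ ≤ ‖b i‖) :
    supPow Φ w p a ≤ supPow Φ w p b := by
  refine iSup₂_le fun φ hφ => le_trans (ENNReal.tsum_le_tsum fun n => ?_) (tsum_le_supPow b hφ)
  gcongr
  exact enorm_le_iff_norm_le.2 (h _)

/-- Fatou property: `supPow` is a supremum of finite sums, each continuous for coordinatewise
convergence. Both completeness and bounded completeness come from it. -/
theorem supPow_le_of_tendsto {ι : Type*} {l : Filter ι} [l.NeBot] {F : ι → ℕ → 𝕜} {a : ℕ → 𝕜}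
    {C : ℝ≥0∞}
    (h : ∀ i, Tendsto (fun m => F m i) l (𝓝 (a i))) (hC : ∀ᶠ m in l, supPow Φ w p (F m) ≤ C) :
    supPow Φ w p a ≤ C := by
  rw [supPow_le_iff]
  intro φ hφ N
  refine le_of_tendsto (x := l)
    (f := fun m => ∑ n ∈ Finset.range N, ‖F m (φ n)‖ₑ ^ (p : ℝ) * ENNReal.ofReal (w n)) ?_
    (hC.mono fun m hm => supPow_le_iff.1 hm φ hφ N)
  refine tendsto_finsetSum _ fun n _ => ENNReal.Tendsto.mul_const ?_ (Or.inr ENNReal.ofReal_ne_top)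
  exact ((ENNReal.continuous_rpow_const.comp continuous_enorm).tendsto _).comp (h _)

/-- For each single `φ` the sum is additive on disjoint supports; only the supremum loses equality.
-/
theorem supPow_add_le_of_disjoint (hp : 1 ≤ p) {a b : ℕ → 𝕜} (h : ∀ i, a i = 0 ∨ b i = 0) :
    supPow Φ w p (a + b) ≤ supPow Φ w p a + supPow Φ w p b := by
  have h0 : (0 : ℝ) < p := by exact_mod_cast lt_of_lt_of_le one_pos hp
  refine iSup₂_le fun φ hφ =>
    le_trans (le_of_eq ?_) (add_le_add (tsum_le_supPow a hφ) (tsum_le_supPow b hφ))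
  rw [← ENNReal.tsum_add]
  refine tsum_congr fun n => ?_
  rcases h (φ n) with h | h <;> simp [h, ENNReal.zero_rpow_of_pos h0]

end supPow

/-! ### Completeness, coordinate functionals and coordinate projections -/

namespace SupSpace

variable {𝕜 : Type*} [RCLike 𝕜] {Φ : Set (ℕ → ℕ)} {w : Weight} {p : ℝ≥0} [hp : Fact (1 ≤ p)]

theorem coe_pos (p : ℝ≥0) [hp : Fact (1 ≤ p)] : (0 : ℝ) < p := by
  exact_mod_cast lt_of_lt_of_le one_pos hp.out

@[simp] theorem toSeq_mk (a : ℕ → 𝕜) (ha : supENorm Φ w p a < ∞) : toSeq (mk a ha) = a := rfl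

@[ext] theorem ext {f g : SupSpace 𝕜 Φ w p} (h : ∀ i, toSeq f i = toSeq g i) : f = g :=
  toSeq_injective (funext h)

theorem supPow_toSeq (f : SupSpace 𝕜 Φ w p) :
    supPow Φ w p (toSeq f) = ENNReal.ofReal (‖f‖ ^ (p : ℝ)) := by
  rw [← supENorm_rpow hp.out, norm_def, ← ENNReal.ofReal_rpow_of_nonneg ENNReal.toReal_nonneg
    (coe_pos p).le, ENNReal.ofReal_toReal (supENorm_lt_top f).ne]

variable [IsAdmissible Φ]

@[simp] theorem toSeq_unitVector (n : ℕ) :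
    toSeq (unitVector 𝕜 Φ w p n) = Pi.single n 1 := rfl

theorem norm_le_iff {f : SupSpace 𝕜 Φ w p} {C : ℝ} (hC : 0 ≤ C) :
    ‖f‖ ≤ C ↔ supPow Φ w p (toSeq f) ≤ ENNReal.ofReal (C ^ (p : ℝ)) := by
  rw [supPow_toSeq, ENNReal.ofReal_le_ofReal_iff (by positivity),
    Real.rpow_le_rpow_iff (norm_nonneg _) hC (coe_pos p)]

theorem norm_le_norm_of_forall_le {f g : SupSpace 𝕜 Φ w p}
    (h : ∀ i, ‖toSeq f i‖ ≤ ‖toSeq g i‖) : ‖f‖ ≤ ‖g‖ := by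
  rw [norm_le_iff (norm_nonneg _), ← supPow_toSeq]
  exact supPow_mono h

theorem exists_of_supPow_le {a : ℕ → 𝕜} {C : ℝ} (hC : 0 ≤ C)
    (h : supPow Φ w p a ≤ ENNReal.ofReal (C ^ (p : ℝ))) :
    ∃ f : SupSpace 𝕜 Φ w p, toSeq f = a ∧ ‖f‖ ≤ C :=
  ⟨mk a ((supENorm_lt_top_iff hp.out a).2 (h.trans_lt ENNReal.ofReal_lt_top)), rfl,
    (norm_le_iff hC).2 h⟩

theorem exists_of_forall_le {a : ℕ → 𝕜} (g : SupSpace 𝕜 Φ w p) {C : ℝ} (hC : 0 ≤ C)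
    (h : ∀ i, ‖a i‖ ≤ C * ‖toSeq g i‖) :
    ∃ f : SupSpace 𝕜 Φ w p, toSeq f = a ∧ ‖f‖ ≤ C * ‖g‖ := by
  refine exists_of_supPow_le (by positivity) ?_
  have : ‖(C : 𝕜) • g‖ = C * ‖g‖ := by
    rw [norm_smul, RCLike.norm_ofReal, abs_of_nonneg hC]
  rw [← this, ← supPow_toSeq]
  refine supPow_mono fun i => (h i).trans (le_of_eq ?_)
  rw [map_smul, Pi.smul_apply, norm_smul, RCLike.norm_ofReal, abs_of_nonneg hC]

theorem exists_of_tendsto {ι : Type*} {l : Filter ι} [l.NeBot] {F : ι → SupSpace 𝕜 Φ w p}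
    {a : ℕ → 𝕜} {C : ℝ} (hC0 : 0 ≤ C)
    (h : ∀ i, Tendsto (fun m => toSeq (F m) i) l (𝓝 (a i))) (hC : ∀ᶠ m in l, ‖F m‖ ≤ C) :
    ∃ f : SupSpace 𝕜 Φ w p, toSeq f = a ∧ ‖f‖ ≤ C :=
  exists_of_supPow_le hC0 (supPow_le_of_tendsto h (hC.mono fun _ hm => (norm_le_iff hC0).1 hm))

theorem norm_apply_le (f : SupSpace 𝕜 Φ w p) (i : ℕ) : ‖toSeq f i‖ ≤ ‖f‖ := by
  have := enorm_apply_le_supENorm Φ w p hp.out (toSeq f) i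
  rw [norm_def, ← toReal_enorm]
  exact ENNReal.toReal_mono (supENorm_lt_top f).ne this

variable (𝕜 Φ w p) in
/-- The coordinate functionals. -/
def coord (i : ℕ) : SupSpace 𝕜 Φ w p →L[𝕜] 𝕜 :=
  LinearMap.mkContinuous ((LinearMap.proj i).comp toSeq) 1 fun f => by
    simpa using norm_apply_le f i

@[simp] theorem coord_apply (i : ℕ) (f : SupSpace 𝕜 Φ w p) : coord 𝕜 Φ w p i f = toSeq f i := rfl

instance : CompleteSpace (SupSpace 𝕜 Φ w p) := by
  refine Metric.complete_of_cauchySeq_tendsto fun u hu => ?_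
  have hc : ∀ i, ∃ a, Tendsto (fun n => toSeq (u n) i) atTop (𝓝 a) := fun i =>
    cauchySeq_tendsto_of_complete (hu.map (coord 𝕜 Φ w p i).uniformContinuous)
  choose a ha using hc
  obtain ⟨R, -, hR⟩ := cauchySeq_bdd hu
  obtain ⟨f, rfl, -⟩ := exists_of_tendsto (C := R + ‖u 0‖)
    (add_nonneg (dist_nonneg.trans (hR 0 0).le) (norm_nonneg _)) ha (Eventually.of_forall fun m => by
      have h1 := (hR m 0).le
      rw [dist_eq_norm] at h1
      linarith [norm_sub_norm_le (u m) (u 0)])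
  refine ⟨f, Metric.tendsto_atTop.2 fun ε hε => ?_⟩
  obtain ⟨N, hN⟩ := Metric.cauchySeq_iff.1 hu (ε / 2) (by positivity)
  refine ⟨N, fun n hn => ?_⟩
  -- Letting `m → ∞` in `‖u n - u m‖ ≤ ε / 2` by the Fatou property bounds `‖u n - f‖`.
  obtain ⟨g, hg, hg'⟩ := exists_of_tendsto (l := atTop) (F := fun m => u n - u m)
    (a := toSeq (u n - f)) (C := ε / 2) (by positivity)
    (fun i => by simpa using (ha i).const_sub (toSeq (u n) i))
    ((eventually_ge_atTop N).mono fun m hm => by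
      rw [← dist_eq_norm]; exact (hN n hn m hm).le)
  rw [dist_eq_norm, ← toSeq_injective hg]
  linarith

variable (𝕜 Φ w p) in
/-- The projection onto the coordinates in `A`. -/
def restrict (A : Set ℕ) : SupSpace 𝕜 Φ w p →L[𝕜] SupSpace 𝕜 Φ w p :=
  LinearMap.mkContinuous
    { toFun := fun f => mk (A.indicator (toSeq f))
        ((supENorm_lt_top_iff hp.out _).2 ((supPow_mono fun _ => norm_indicator_le_norm_self _ _).trans_lt
          ((supENorm_lt_top_iff hp.out _).1 (supENorm_lt_top f))))
      map_add' := fun f g => ext fun i => by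
        by_cases h : i ∈ A <;> simp [h]
      map_smul' := fun c f => ext fun i => by
        by_cases h : i ∈ A <;> simp [h] } 1 fun f => by
    rw [one_mul]
    exact norm_le_norm_of_forall_le fun _ => norm_indicator_le_norm_self _ _

@[simp] theorem toSeq_restrict (A : Set ℕ) (f : SupSpace 𝕜 Φ w p) :
    toSeq (restrict 𝕜 Φ w p A f) = A.indicator (toSeq f) := rfl

theorem norm_restrict_le (A : Set ℕ) (f : SupSpace 𝕜 Φ w p) : ‖restrict 𝕜 Φ w p A f‖ ≤ ‖f‖ :=
  norm_le_norm_of_forall_le fun _ => norm_indicator_le_norm_self _ _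

theorem restrict_add_compl (A : Set ℕ) (f : SupSpace 𝕜 Φ w p) :
    restrict 𝕜 Φ w p A f + restrict 𝕜 Φ w p Aᶜ f = f := by
  ext i
  by_cases h : i ∈ A <;> simp [h]

theorem toSeq_sum_smul_unitVector (a : ℕ → 𝕜) (s : Finset ℕ) (i : ℕ) :
    toSeq (∑ j ∈ s, a j • unitVector 𝕜 Φ w p j) i = if i ∈ s then a i else 0 := by
  simp [map_sum, Finset.sum_apply, Pi.single_apply]

theorem norm_unitVector_le (i : ℕ) : ‖unitVector 𝕜 Φ w p i‖ ≤ 1 := by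
  have h0 := coe_pos p
  rw [norm_le_iff zero_le_one, Real.one_rpow, ENNReal.ofReal_one]
  refine iSup₂_le fun φ hφ => ?_
  have hinj := IsAdmissible.injective (Φ := Φ) φ hφ
  by_cases h : ∃ n, φ n = i
  · obtain ⟨n, rfl⟩ := h
    rw [tsum_eq_single n]
    · simpa [w.zero_eq_one] using w.antitone (Nat.zero_le n)
    · intro m hm
      simp [hinj.eq_iff, hm, h0]
  · push Not at h
    simp [h, h0]

theorem sum_smul_unitVector (f : SupSpace 𝕜 Φ w p) (s : Finset ℕ) :
    ∑ j ∈ s, toSeq f j • unitVector 𝕜 Φ w p j = restrict 𝕜 Φ w p (s : Set ℕ) f := by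
  ext i
  rw [toSeq_sum_smul_unitVector, toSeq_restrict]
  by_cases h : i ∈ s <;> simp [h]

theorem norm_rpow_add_le_of_disjoint {f g : SupSpace 𝕜 Φ w p}
    (h : ∀ i, toSeq f i = 0 ∨ toSeq g i = 0) :
    ‖f + g‖ ^ (p : ℝ) ≤ ‖f‖ ^ (p : ℝ) + ‖g‖ ^ (p : ℝ) := by
  have := supPow_add_le_of_disjoint (Φ := Φ) (w := w) hp.out h
  rw [← map_add, supPow_toSeq, supPow_toSeq, supPow_toSeq, ← ENNReal.ofReal_add (by positivity)
    (by positivity), ENNReal.ofReal_le_ofReal_iff (by positivity)] at this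
  exact this

end SupSpace

/-! ### The unit vectors form a boundedly complete basis of the Garling space -/

namespace Garling

open SupSpace

variable {𝕜 : Type*} [RCLike 𝕜] {w : Weight} {p : ℝ≥0} [hp : Fact (1 ≤ p)]

theorem ofReal_term (f : Garling 𝕜 w p) (i n : ℕ) :
    ‖toSeq f i‖ₑ ^ (p : ℝ) * ENNReal.ofReal (w n)
      = ENNReal.ofReal (‖toSeq f i‖ ^ (p : ℝ) * w n) := by
  rw [ENNReal.ofReal_mul (by positivity), ← ofReal_norm,
    ENNReal.ofReal_rpow_of_nonneg (norm_nonneg _) (coe_pos p).le]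

theorem term_nonneg (f : Garling 𝕜 w p) (i n : ℕ) : 0 ≤ ‖toSeq f i‖ ^ (p : ℝ) * w n :=
  mul_nonneg (by positivity) (w.pos n).le

theorem sum_le_norm_rpow_of_strictMono (f : Garling 𝕜 w p) {φ : ℕ → ℕ} (hφ : StrictMono φ)
    (s : Finset ℕ) : ∑ n ∈ s, ‖toSeq f (φ n)‖ ^ (p : ℝ) * w n ≤ ‖f‖ ^ (p : ℝ) := by
  rw [← ENNReal.ofReal_le_ofReal_iff (by positivity), ← supPow_toSeq,
    ENNReal.ofReal_sum_of_nonneg fun n _ => term_nonneg f _ n]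
  simp_rw [← ofReal_term]
  exact (ENNReal.sum_le_tsum s).trans (tsum_le_supPow (Φ := increasingMaps) (toSeq f) hφ)

/-- Gaps in the indices of the weights only decrease the sums. -/
theorem sum_le_norm_rpow (f : Garling 𝕜 w p) {J : Set ℕ} (hJ : J.Infinite) {ψ : ℕ → ℕ}
    (hψ : StrictMonoOn ψ J) {s : Finset ℕ} (hs : (s : Set ℕ) ⊆ J) :
    ∑ n ∈ s, ‖toSeq f (ψ n)‖ ^ (p : ℝ) * w n ≤ ‖f‖ ^ (p : ℝ) := by
  classical
  have hJ' : (Set.ofPred (· ∈ J)).Infinite := hJ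
  have hmem : ∀ n, Nat.nth (· ∈ J) n ∈ J := Nat.nth_mem_of_infinite hJ'
  have hmono := Nat.nth_strictMono hJ'
  have hφ : StrictMono fun n => ψ (Nat.nth (· ∈ J) n) := fun m n hmn =>
    hψ (hmem m) (hmem n) (hmono hmn)
  have hc : ∀ n ∈ s, Nat.nth (· ∈ J) (Nat.count (· ∈ J) n) = n := fun n hn =>
    Nat.nth_count (p := (· ∈ J)) (hs hn)
  -- Enumerating `J` turns `ψ` into a genuine increasing map. An element `n` of `J` then sits at
  -- position `count n ≤ n`, where the weight is at least `w n`.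
  refine le_trans ?_ (sum_le_norm_rpow_of_strictMono f hφ (s.image (Nat.count (· ∈ J))))
  rw [Finset.sum_image fun m hm n hn h => by
    rw [← hc m hm, ← hc n hn, h]]
  refine Finset.sum_le_sum fun n hn => ?_
  rw [hc n hn]
  exact mul_le_mul_of_nonneg_left (w.antitone (Nat.count_le _)) (by positivity)

theorem exists_lt_sum (f : Garling 𝕜 w p) {c : ℝ} (hc : c < ‖f‖ ^ (p : ℝ)) :
    ∃ φ : ℕ → ℕ, StrictMono φ ∧ ∃ N,
      c < ∑ n ∈ Finset.range N, ‖toSeq f (φ n)‖ ^ (p : ℝ) * w n := by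
  by_contra! h
  have h0 : 0 ≤ c := by simpa using h id strictMono_id 0
  refine hc.not_ge ?_
  rw [← ENNReal.ofReal_le_ofReal_iff h0, ← supPow_toSeq, supPow_le_iff]
  intro φ hφ N
  simp_rw [ofReal_term]
  rw [← ENNReal.ofReal_sum_of_nonneg fun n _ => term_nonneg f _ n]
  exact ENNReal.ofReal_le_ofReal (h φ hφ N)

/-- If infinitely many coordinates had modulus at least `δ`, their increasing enumeration would give
sums above `δ ^ p * ∑ w n`, which diverges. -/
theorem tendsto_apply_zero (f : Garling 𝕜 w p) : Tendsto (toSeq f) atTop (𝓝 0) := by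
  by_contra h
  rw [Metric.tendsto_atTop] at h
  push Not at h
  obtain ⟨δ, hδ, h⟩ := h
  simp only [dist_zero_right] at h
  have hinf : (Set.ofPred fun n => δ ≤ ‖toSeq f n‖).Infinite :=
    Set.infinite_of_not_bddAbove fun ⟨N, hN⟩ => by
      obtain ⟨n, hn, hn'⟩ := h (N + 1)
      exact absurd (hN hn') (by omega)
  obtain ⟨N, hN⟩ := ((tendsto_atTop.1 w.sum_range_tendsto) (‖f‖ ^ (p : ℝ) / δ ^ (p : ℝ) + 1)).exists
  have h1 := sum_le_norm_rpow_of_strictMono f (Nat.nth_strictMono hinf) (Finset.range N)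
  have h2 : δ ^ (p : ℝ) * ∑ n ∈ Finset.range N, w n ≤ ‖f‖ ^ (p : ℝ) := by
    refine le_trans ?_ h1
    rw [Finset.mul_sum]
    refine Finset.sum_le_sum fun n _ => mul_le_mul_of_nonneg_right ?_ (w.pos n).le
    exact Real.rpow_le_rpow hδ.le (Nat.nth_mem_of_infinite hinf n) (coe_pos p).le
  have h3 : 0 < δ ^ (p : ℝ) := by positivity
  have h4 := mul_le_mul_of_nonneg_left hN h3.le
  rw [mul_add, mul_div_cancel₀ _ h3.ne'] at h4
  linarith

/-- The tails of an element converge to `0`. -/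
theorem tendsto_tail (f : Garling 𝕜 w p) :
    Tendsto (fun N => restrict 𝕜 increasingMaps w p (Set.Ici N) f) atTop (𝓝 0) := by
  set t : ℕ → ℝ := fun N => ‖restrict 𝕜 increasingMaps w p (Set.Ici N) f‖ ^ (p : ℝ) with ht
  have hle : ∀ {M N : ℕ}, M ≤ N → ∀ i, ‖toSeq (restrict 𝕜 increasingMaps w p (Set.Ici N) f) i‖
      ≤ ‖toSeq (restrict 𝕜 increasingMaps w p (Set.Ici M) f) i‖ := fun {M N} hMN i =>
    norm_indicator_le_of_subset (Set.Ici_subset_Ici.2 hMN) _ _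
  have hanti : Antitone t := fun M N hMN => Real.rpow_le_rpow (norm_nonneg _)
    (norm_le_norm_of_forall_le (hle hMN)) (coe_pos p).le
  have hbdd : BddBelow (Set.range t) := ⟨0, by rintro _ ⟨N, rfl⟩; positivity⟩
  have hlim := tendsto_atTop_ciInf hanti hbdd
  set L := ⨅ N, t N
  have hLle : ∀ N, L ≤ t N := fun N => ciInf_le hbdd N
  have hL0 : 0 ≤ L := le_ciInf fun N => by positivity
  have hL : L = 0 := by
    by_contra hne
    have hLpos : 0 < L := lt_of_le_of_ne hL0 (Ne.symm hne)
    -- Two pieces worth `3/4 * L` each, minus a loss of `1/8 * L`, add up to `11/8 * L`, which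
    -- exceeds `t N < 5/4 * L`.
    obtain ⟨N, hN⟩ := (hlim.eventually (gt_mem_nhds (by linarith : L < 5 / 4 * L))).exists
    obtain ⟨φ, hφ, m, hm⟩ := exists_lt_sum _ (show 3 / 4 * L < t N by linarith [hLle N])
    have hsmall : Tendsto (fun i => (m : ℝ) * ‖toSeq f i‖ ^ (p : ℝ)) atTop (𝓝 0) := by
      have := ((tendsto_apply_zero f).norm.rpow_const (Or.inr (coe_pos p).le)).const_mul (m : ℝ)
      simpa [Real.zero_rpow (coe_pos p).ne'] using this
    obtain ⟨N₁, hN₁⟩ := eventually_atTop.1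
      (hsmall.eventually (gt_mem_nhds (by linarith : 0 < 1 / 8 * L)))
    -- Beyond `M` the coordinates are so small that the first `m` terms of any sum are worth at most
    -- `1/8 * L`, and `M` lies past every coordinate used by `φ` on `[0, m)`.
    set M := N₁ + N + φ m with hM
    obtain ⟨φ', hφ', m', hm'⟩ := exists_lt_sum _ (show 3 / 4 * L < t M by linarith [hLle M])
    set g := restrict 𝕜 increasingMaps w p (Set.Ici N) f
    set g' := restrict 𝕜 increasingMaps w p (Set.Ici M) f
    have hg' : ∀ i, i < M → toSeq g' i = 0 := fun i hi => by simp [g', hi]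
    have hbound : ∑ n ∈ Finset.range m, ‖toSeq g' (φ' n)‖ ^ (p : ℝ) * w n ≤ 1 / 8 * L := by
      rcases Nat.eq_zero_or_pos m with rfl | hmpos
      · simp; positivity
      have hm0 : (0 : ℝ) < m := by exact_mod_cast hmpos
      have : ∀ n ∈ Finset.range m, ‖toSeq g' (φ' n)‖ ^ (p : ℝ) * w n ≤ 1 / 8 * L / m := by
        intro n _
        have hw1 : w n ≤ 1 := by simpa [w.zero_eq_one] using w.antitone (Nat.zero_le n)
        have : ‖toSeq g' (φ' n)‖ ^ (p : ℝ) ≤ 1 / 8 * L / m := by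
          rcases lt_or_ge (φ' n) M with h | h
          · rw [hg' _ h, norm_zero, Real.zero_rpow (coe_pos p).ne']; positivity
          · rw [le_div_iff₀ hm0, mul_comm]
            have h1 := (hN₁ (φ' n) (by omega)).le
            have : toSeq g' (φ' n) = toSeq f (φ' n) := by simp [g', h]
            rwa [this]
        exact (mul_le_of_le_one_right (by positivity) hw1).trans this
      refine (Finset.sum_le_sum this).trans (le_of_eq ?_)
      rw [Finset.sum_const, Finset.card_range, nsmul_eq_mul]
      field_simp
    -- Gluing: weights below `m` follow `φ`, later ones follow `φ'`. The indices left out have `φ' n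
    -- < M`, where `g'` vanishes, so they cost nothing.
    set J : Set ℕ := {n | n < m ∨ M ≤ φ' n} with hJ
    set ψ : ℕ → ℕ := fun n => if n < m then φ n else φ' n with hψ
    have hJinf : J.Infinite := (Set.Ici_infinite M).mono fun n hn =>
      Or.inr (le_trans hn (hφ'.le_apply))
    have hmono : StrictMonoOn ψ J := by
      intro a ha b hb hab
      by_cases h1 : b < m
      · simp only [hψ, hab.trans h1, h1, if_true]; exact hφ hab
      · by_cases h2 : a < m
        · simp only [hψ, h1, h2, if_true, if_false]
          rcases hb with hb | hb
          · exact absurd hb h1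
          · have := hφ h2; omega
        · simp only [hψ, h1, h2, if_false]; exact hφ' hab
    set s : Finset ℕ := (Finset.range (max m m')).filter (· ∈ J) with hs
    have key := sum_le_norm_rpow g hJinf hmono (s := s) (fun n hn => by
      simp [hs] at hn; exact hn.2)
    have key2 : ∑ n ∈ s, ‖toSeq g (ψ n)‖ ^ (p : ℝ) * w n
        ≥ ∑ n ∈ Finset.range m, ‖toSeq g (φ n)‖ ^ (p : ℝ) * w n
          + (∑ n ∈ Finset.range m', ‖toSeq g' (φ' n)‖ ^ (p : ℝ) * w n
            - ∑ n ∈ Finset.range m, ‖toSeq g' (φ' n)‖ ^ (p : ℝ) * w n) := by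
      have e1 : ∑ n ∈ s, ‖toSeq g (ψ n)‖ ^ (p : ℝ) * w n
          ≥ ∑ n ∈ s, ((if n < m then ‖toSeq g (φ n)‖ ^ (p : ℝ) * w n else 0)
            + (‖toSeq g' (φ' n)‖ ^ (p : ℝ) * w n
            - if n < m then ‖toSeq g' (φ' n)‖ ^ (p : ℝ) * w n else 0)) := by
        refine Finset.sum_le_sum fun n _ => ?_
        by_cases h : n < m
        · simp [hψ, h]
        · simp only [hψ, h, if_false, sub_zero, zero_add]
          exact mul_le_mul_of_nonneg_right (Real.rpow_le_rpow (norm_nonneg _)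
            (hle (by omega) _) (coe_pos p).le) (w.pos n).le
      have e2 : ∑ n ∈ s, ((if n < m then ‖toSeq g (φ n)‖ ^ (p : ℝ) * w n else 0)
            + (‖toSeq g' (φ' n)‖ ^ (p : ℝ) * w n
            - if n < m then ‖toSeq g' (φ' n)‖ ^ (p : ℝ) * w n else 0))
          = ∑ n ∈ Finset.range (max m m'),
            ((if n < m then ‖toSeq g (φ n)‖ ^ (p : ℝ) * w n else 0)
            + (‖toSeq g' (φ' n)‖ ^ (p : ℝ) * w n
            - if n < m then ‖toSeq g' (φ' n)‖ ^ (p : ℝ) * w n else 0)) := by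
        refine Finset.sum_subset (Finset.filter_subset _ _) fun n hn hn' => ?_
        have hnJ : n ∉ J := fun h => hn' (Finset.mem_filter.2 ⟨hn, h⟩)
        simp only [hJ, Set.mem_ofPred_eq, not_or, not_le] at hnJ
        simp [hnJ.1, hg' _ hnJ.2, Real.zero_rpow (coe_pos p).ne']
      have e3 : ∀ u : ℕ → ℝ, ∑ n ∈ Finset.range (max m m'), (if n < m then u n else 0)
          = ∑ n ∈ Finset.range m, u n := fun u => by
        rw [← Finset.sum_filter]
        congr 1
        ext n; simp; omega
      rw [e2, Finset.sum_add_distrib, Finset.sum_sub_distrib, e3, e3] at e1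
      have e4 : ∑ n ∈ Finset.range m', ‖toSeq g' (φ' n)‖ ^ (p : ℝ) * w n
          ≤ ∑ n ∈ Finset.range (max m m'), ‖toSeq g' (φ' n)‖ ^ (p : ℝ) * w n :=
        Finset.sum_le_sum_of_subset_of_nonneg (Finset.range_mono (le_max_right _ _))
          fun n _ _ => term_nonneg g' _ n
      linarith
    have : t N = ‖g‖ ^ (p : ℝ) := rfl
    linarith
  rw [hL] at hlim
  have h2 := hlim.rpow_const (p := (p : ℝ)⁻¹) (Or.inr (inv_nonneg.2 (coe_pos p).le))
  rw [Real.zero_rpow (inv_ne_zero (coe_pos p).ne')] at h2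
  rw [tendsto_zero_iff_norm_tendsto_zero]
  refine h2.congr fun N => ?_
  rw [ht]
  exact Real.rpow_rpow_inv (norm_nonneg _) (coe_pos p).ne'

theorem tendsto_restrict_Iio (f : Garling 𝕜 w p) :
    Tendsto (fun N => restrict 𝕜 increasingMaps w p (Set.Iio N) f) atTop (𝓝 f) := by
  have h := (tendsto_tail f).const_sub f
  rw [sub_zero] at h
  refine h.congr fun N => ?_
  rw [sub_eq_iff_eq_add, ← Set.compl_Iio, restrict_add_compl]

theorem tendsto_sum_unit (f : Garling 𝕜 w p) :
    Tendsto (fun N => ∑ i ∈ Finset.range N, toSeq f i • garlingUnit 𝕜 w p i) atTop (𝓝 f) := by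
  refine (tendsto_restrict_Iio f).congr fun N => ?_
  rw [sum_smul_unitVector, Finset.coe_range]

theorem isSchauderBasis_unit : IsSchauderBasis 𝕜 (garlingUnit 𝕜 w p) :=
  ⟨{ basis := garlingUnit 𝕜 w p
     coord := coord 𝕜 increasingMaps w p
     ortho := fun i j => by simp [Pi.single_apply]
     expansion := fun f => by
      rw [HasSum, SummationFilter.conditional_filter_eq_map_range, tendsto_map'_iff]
      exact tendsto_sum_unit f }, fun _ => rfl⟩

theorem closedSpan_unit : closedSpan 𝕜 (garlingUnit 𝕜 w p) = ⊤ := by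
  refine eq_top_iff.2 fun f _ => ?_
  refine mem_closure_of_tendsto (tendsto_sum_unit f) (Eventually.of_forall fun N => ?_)
  exact Submodule.sum_mem _ fun i _ => Submodule.smul_mem _ _ (Submodule.subset_span ⟨i, rfl⟩)

/-- The partial sums converge coordinatewise to `a`, so the Fatou property bounds `a` itself. Serves
both bounded completeness and reflexivity. -/
theorem exists_of_norm_sum_le (a : ℕ → 𝕜) {C : ℝ}
    (hC : ∀ n, ‖∑ i ∈ Finset.range n, a i • garlingUnit 𝕜 w p i‖ ≤ C) :
    ∃ f : Garling 𝕜 w p, toSeq f = a ∧ ‖f‖ ≤ C := by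
  refine exists_of_tendsto (l := atTop) ((norm_nonneg _).trans (hC 0)) (fun i => ?_) (Eventually.of_forall hC)
  refine tendsto_const_nhds.congr' ((eventually_gt_atTop i).mono fun n hn => ?_)
  exact ((toSeq_sum_smul_unitVector a _ i).trans (if_pos (Finset.mem_range.2 hn))).symm

theorem isBoundedlyComplete_unit : IsBoundedlyComplete 𝕜 (garlingUnit 𝕜 w p) := by
  rintro a ⟨C, hC⟩
  obtain ⟨f, rfl, -⟩ := exists_of_norm_sum_le a hC
  exact ⟨f, tendsto_sum_unit f⟩

end Garling

/-- Dependent choice, with the relation depending on the step. -/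
theorem exists_seq_step {α : Type*} (P : ℕ → α → α → Prop) (h : ∀ k s, ∃ t, P k s t) (a : α) :
    ∃ u : ℕ → α, u 0 = a ∧ ∀ k, P k (u k) (u (k + 1)) := by
  choose f hf using h
  exact ⟨fun n => Nat.rec a f n, rfl, fun k => hf k _⟩

/-- The intervals `[N k, N (k + 1))` partition `ℕ`; `b i` names the one containing `i`. -/
theorem exists_block_index {N : ℕ → ℕ} (hN : StrictMono N) (h0 : N 0 = 0) :
    ∃ b : ℕ → ℕ, ∀ i k, b i = k ↔ N k ≤ i ∧ i < N (k + 1) := by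
  classical
  have hex : ∀ i, ∃ k, i < N (k + 1) := fun i => ⟨i, (Nat.lt_succ_self i).trans_le hN.le_apply⟩
  refine ⟨fun i => Nat.find (hex i), fun i k => ?_⟩
  rw [Nat.find_eq_iff]
  constructor
  · rintro ⟨h1, h2⟩
    refine ⟨?_, h1⟩
    cases k with
    | zero => omega
    | succ k => exact not_lt.1 (h2 k (Nat.lt_succ_self k))
  · rintro ⟨h1, h2⟩
    exact ⟨h2, fun n hn h => by
      have := hN.monotone (show n + 1 ≤ k from hn)
      omega⟩

/-! ### Perturbation of left inverses, and complemented ranges -/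

section Operators

variable {𝕜 : Type*} [RCLike 𝕜] {X E : Type*} [NormedAddCommGroup X] [NormedSpace 𝕜 X]
  [NormedAddCommGroup E] [NormedSpace 𝕜 E]

/-- An operator with an approximate left inverse has a left inverse. -/
theorem exists_leftInverse_of_approx [CompleteSpace E] (T : E →L[𝕜] X) (S : X →L[𝕜] E) {κ : ℝ}
    (hκ : κ < 1) (h : ‖S ∘L T - ContinuousLinearMap.id 𝕜 E‖ ≤ κ) :
    ∃ S' : X →L[𝕜] E, S' ∘L T = ContinuousLinearMap.id 𝕜 E ∧ ‖S'‖ ≤ ‖S‖ / (1 - κ) := by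
  have hlt : ‖ContinuousLinearMap.id 𝕜 E - S ∘L T‖ < 1 := by
    rw [norm_sub_rev]; exact h.trans_lt hκ
  have hu : ((Units.oneSub (ContinuousLinearMap.id 𝕜 E - S ∘L T) hlt : (E →L[𝕜] E)ˣ) : E →L[𝕜] E)
      = S ∘L T := by
    rw [Units.val_oneSub]
    exact sub_sub_cancel _ _
  set u := Units.oneSub (ContinuousLinearMap.id 𝕜 E - S ∘L T) hlt
  have h1 : ∀ y : E, (S ∘L T) ((↑u⁻¹ : E →L[𝕜] E) y) = y := fun y => by
    rw [← hu]; exact DFunLike.congr_fun (u.mul_inv) y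
  have h2 : ∀ y : E, (↑u⁻¹ : E →L[𝕜] E) ((S ∘L T) y) = y := fun y => by
    rw [← hu]; exact DFunLike.congr_fun (u.inv_mul) y
  refine ⟨(↑u⁻¹ : E →L[𝕜] E) ∘L S, ContinuousLinearMap.ext fun y => h2 y, ?_⟩
  have hpos : 0 < 1 - κ := by linarith
  refine ContinuousLinearMap.opNorm_le_bound _ (by positivity) fun x => ?_
  set z := (↑u⁻¹ : E →L[𝕜] E) (S x) with hz
  -- As `S (T z) = S x`, this gives `(1 - κ) ‖z‖ ≤ ‖S x‖`, hence the bound on the left inverse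
  -- without estimating the inverse of `S ∘L T` separately.
  have h3 : ‖(S ∘L T) z - z‖ ≤ κ * ‖z‖ :=
    (ContinuousLinearMap.le_opNorm (S ∘L T - ContinuousLinearMap.id 𝕜 E) z).trans (by gcongr)
  have h4 : (S ∘L T) z = S x := h1 (S x)
  rw [h4] at h3
  have h5 : ‖z‖ ≤ ‖S x - z‖ + ‖S x‖ := by
    have := norm_sub_le (S x) (S x - z)
    rw [sub_sub_cancel] at this
    linarith
  have h6 := S.le_opNorm x
  change ‖z‖ ≤ _
  rw [div_mul_eq_mul_div, le_div_iff₀ hpos]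
  nlinarith

/-- An operator `y ↦ ∑ a_k(y) z_k`, for contractive functionals `a_k` and an absolutely summable
sequence `z_k`. -/
theorem exists_clm_of_summable [CompleteSpace X] (a : ℕ → E →L[𝕜] 𝕜) (ha : ∀ k, ‖a k‖ ≤ 1)
    (z : ℕ → X) {B : ℝ} (hz : Summable fun k => ‖z k‖) (hB : ∑' k, ‖z k‖ ≤ B) :
    ∃ T : E →L[𝕜] X, (∀ y, HasSum (fun k => a k y • z k) (T y)) ∧ ‖T‖ ≤ B := by
  have hle : ∀ k, ‖(a k).smulRight (z k)‖ ≤ ‖z k‖ := fun k => by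
    rw [ContinuousLinearMap.norm_smulRight_apply]
    exact mul_le_of_le_one_left (norm_nonneg _) (ha k)
  have hs : Summable fun k => (a k).smulRight (z k) := Summable.of_norm_bounded hz hle
  refine ⟨∑' k, (a k).smulRight (z k), fun y => ?_, (tsum_of_norm_bounded hz.hasSum hle).trans hB⟩
  simpa using (ContinuousLinearMap.apply 𝕜 X y).hasSum hs.hasSum

/-- The range is the fixed-point set of the continuous projection `T ∘L S`. -/
theorem isClosed_range_of_leftInverse {T : E →L[𝕜] X} {S : X →L[𝕜] E}
    (h : S ∘L T = ContinuousLinearMap.id 𝕜 E) :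
    IsClosed (LinearMap.range (T : E →ₗ[𝕜] X) : Set X) := by
  have hST : ∀ y, S (T y) = y := DFunLike.congr_fun h
  have : (LinearMap.range (T : E →ₗ[𝕜] X) : Set X) = {x | T (S x) = x} := by
    ext x
    constructor
    · rintro ⟨y, rfl⟩
      exact congrArg T (hST y)
    · intro hx
      exact ⟨S x, hx⟩
  rw [this]
  exact isClosed_eq (T.continuous.comp S.continuous) continuous_id

theorem isIsomorphicWith_range {T : E →L[𝕜] X} {S : X →L[𝕜] E}
    (h : S ∘L T = ContinuousLinearMap.id 𝕜 E) :
    IsIsomorphicWith 𝕜 (LinearMap.range (T : E →ₗ[𝕜] X)) E (‖T‖ * ‖S‖) := by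
  have hST : ∀ y, S (T y) = y := DFunLike.congr_fun h
  refine ⟨ContinuousLinearEquiv.equivOfInverse (S ∘L (LinearMap.range (T : E →ₗ[𝕜] X)).subtypeL)
    (T.codRestrict _ fun y => ⟨y, rfl⟩) ?_ ?_, ?_⟩
  · rintro ⟨_, y, rfl⟩
    exact Subtype.ext (congrArg T (hST y))
  · exact fun y => hST y
  · rw [mul_comm ‖T‖]
    refine mul_le_mul ?_ ?_ (norm_nonneg _) (norm_nonneg _)
    · exact ContinuousLinearMap.opNorm_le_bound _ (norm_nonneg _) fun y => S.le_opNorm (y : X)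
    · exact ContinuousLinearMap.opNorm_le_bound _ (norm_nonneg _) fun y => T.le_opNorm y

theorem isComplementedWith_range {T : E →L[𝕜] X} {S : X →L[𝕜] E}
    (h : S ∘L T = ContinuousLinearMap.id 𝕜 E) :
    IsComplementedWith (‖T‖ * ‖S‖) (LinearMap.range (T : E →ₗ[𝕜] X)) := by
  have hST : ∀ y, S (T y) = y := DFunLike.congr_fun h
  refine ⟨(T ∘L S).codRestrict _ fun x => ⟨S x, rfl⟩, ?_, ?_⟩
  · rintro ⟨_, y, rfl⟩
    exact Subtype.ext (congrArg T (hST y))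
  · refine ContinuousLinearMap.opNorm_le_bound _ (by positivity) fun x => ?_
    exact ((T ∘L S).le_opNorm x).trans (by gcongr; exact ContinuousLinearMap.opNorm_comp_le T S)

/-- The nonzero scalars `c i` allow for normalization: rescaling vectors does not change their span.
-/
theorem closedSpan_eq_range_of_leftInverse {T : E →L[𝕜] X} {S : X →L[𝕜] E}
    (h : S ∘L T = ContinuousLinearMap.id 𝕜 E) {e : ℕ → E} (he : closedSpan 𝕜 e = ⊤)
    {y : ℕ → X} {c : ℕ → 𝕜} (hc : ∀ i, c i ≠ 0) (hT : ∀ i, T (e i) = c i • y i) :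
    closedSpan 𝕜 y = LinearMap.range (T : E →ₗ[𝕜] X) := by
  refine le_antisymm (Submodule.topologicalClosure_minimal _ ?_ (isClosed_range_of_leftInverse h)) ?_
  · rw [Submodule.span_le]
    rintro _ ⟨i, rfl⟩
    exact ⟨(c i)⁻¹ • e i, by simp [hT, hc i]⟩
  · rintro _ ⟨z, rfl⟩
    have hz : z ∈ closedSpan 𝕜 e := he ▸ Submodule.mem_top
    have hmaps : Set.MapsTo T (Submodule.span 𝕜 (Set.range e) : Set E)
        (Submodule.span 𝕜 (Set.range y) : Set X) := by
      have : Submodule.span 𝕜 (Set.range e)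
          ≤ (Submodule.span 𝕜 (Set.range y)).comap (T : E →ₗ[𝕜] X) := by
        rw [Submodule.span_le]
        rintro _ ⟨i, rfl⟩
        change T (e i) ∈ Submodule.span 𝕜 (Set.range y)
        rw [hT]
        exact Submodule.smul_mem _ _ (Submodule.subset_span ⟨i, rfl⟩)
      exact this
    exact map_mem_closure T.continuous hz hmaps

theorem closedComplemented_of_leftInverse {T : E →L[𝕜] X} {S : X →L[𝕜] E}
    (h : S ∘L T = ContinuousLinearMap.id 𝕜 E) {e : ℕ → E} (he : closedSpan 𝕜 e = ⊤)
    {y : ℕ → X} {c : ℕ → 𝕜} (hc : ∀ i, c i ≠ 0) (hT : ∀ i, T (e i) = c i • y i) :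
    (closedSpan 𝕜 y).ClosedComplemented := by
  rw [closedSpan_eq_range_of_leftInverse h he hc hT]
  obtain ⟨P, hP, -⟩ := isComplementedWith_range h
  exact ⟨P, hP⟩

end Operators

/-! ### Operators on and into `ℓ_p` -/

namespace EllP

variable {𝕜 : Type*} [RCLike 𝕜] {p : ℝ≥0} [hp : Fact (1 ≤ p)]

theorem toReal_pos (p : ℝ≥0) [hp : Fact (1 ≤ p)] : 0 < (p : ℝ≥0∞).toReal := by
  simpa using SupSpace.coe_pos p

theorem closedSpan_single :
    closedSpan 𝕜 (fun i => (lp.single (p : ℝ≥0∞) i (1 : 𝕜) : EllP 𝕜 p)) = ⊤ := by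
  refine eq_top_iff.2 fun f _ => ?_
  refine mem_closure_of_tendsto (lp.hasSum_single ENNReal.coe_ne_top f)
    (Eventually.of_forall fun s => ?_)
  refine Submodule.sum_mem _ fun i _ => ?_
  have : (lp.single (p : ℝ≥0∞) i (f i) : EllP 𝕜 p) = f i • lp.single (p : ℝ≥0∞) i (1 : 𝕜) := by
    rw [← lp.single_smul, smul_eq_mul, mul_one]
  rw [this]
  exact Submodule.smul_mem _ _ (Submodule.subset_span ⟨i, rfl⟩)

variable (𝕜 p) in
/-- The coordinate functionals of `ℓ_p`. -/
abbrev coord (k : ℕ) : EllP 𝕜 p →L[𝕜] 𝕜 := lp.evalCLM 𝕜 (fun _ : ℕ => 𝕜) (p : ℝ≥0∞) k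

theorem coord_apply (k : ℕ) (f : EllP 𝕜 p) : coord 𝕜 p k f = f k := rfl

theorem norm_coord_le (k : ℕ) : ‖coord 𝕜 p k‖ ≤ 1 :=
  ContinuousLinearMap.opNorm_le_bound _ zero_le_one fun f => by
    rw [one_mul]
    exact lp.norm_apply_le_norm (zero_lt_one.trans_le (fact_one_le_coe p).out).ne' f k

/-- An operator into `ℓ_p` from its coordinates. -/
theorem exists_clm_of_coord {X : Type*} [NormedAddCommGroup X] [NormedSpace 𝕜 X]
    (a : ℕ → X →ₗ[𝕜] 𝕜) {C : ℝ} (hC : 0 ≤ C)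
    (h : ∀ f (s : Finset ℕ), ∑ k ∈ s, ‖a k f‖ ^ (p : ℝ) ≤ (C * ‖f‖) ^ (p : ℝ)) :
    ∃ S : X →L[𝕜] EllP 𝕜 p, (∀ f k, S f k = a k f) ∧ ‖S‖ ≤ C := by
  have hmem : ∀ f, Memℓp (fun k => a k f) (p : ℝ≥0∞) := fun f =>
    memℓp_gen' (C := (C * ‖f‖) ^ (p : ℝ)) fun s => by simpa using h f s
  let S₀ : X →ₗ[𝕜] EllP 𝕜 p :=
    { toFun := fun f => ⟨fun k => a k f, hmem f⟩
      map_add' := fun f g => lp.ext (funext fun k => (a k).map_add f g)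
      map_smul' := fun c f => lp.ext (funext fun k => (a k).map_smul c f) }
  have hS : ∀ f, ‖S₀ f‖ ≤ C * ‖f‖ := fun f =>
    lp.norm_le_of_forall_sum_le (toReal_pos p) (by positivity) fun s => by
      rw [ENNReal.coe_toReal]; exact h f s
  exact ⟨S₀.mkContinuous C hS, fun _ _ => rfl, LinearMap.mkContinuous_norm_le _ hC _⟩

theorem tsum_enorm_rpow (c : EllP 𝕜 p) :
    ∑' k, ‖c k‖ₑ ^ (p : ℝ) = ENNReal.ofReal (‖c‖ ^ (p : ℝ)) := by
  have h1 := lp.norm_rpow_eq_tsum (toReal_pos p) c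
  have h2 := (lp.memℓp c).summable (toReal_pos p)
  simp only [ENNReal.coe_toReal] at h1 h2
  rw [h1, ENNReal.ofReal_tsum_of_nonneg (fun _ => by positivity) h2]
  refine tsum_congr fun k => ?_
  rw [← ENNReal.ofReal_rpow_of_nonneg (norm_nonneg _) (SupSpace.coe_pos p).le, ofReal_norm]

end EllP

/-! ### Gliding humps and the almost isometric factorization of `ℓ_p` -/

namespace SupSpace

variable {𝕜 : Type*} [RCLike 𝕜] {Φ : Set (ℕ → ℕ)} [IsAdmissible Φ] {w : Weight} {p : ℝ≥0}
  [hp : Fact (1 ≤ p)]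

/-- Disjointly supported sequences in the unit ball satisfy an upper `p`-estimate: if `b i` is the
index of the sequence whose support contains `i`, and `v` is the sum of the sequences, the operator
`c ↦ (c (b i) v i)` from `ℓ_p` is a contraction. -/
theorem exists_blockOperator (b : ℕ → ℕ) (v : ℕ → 𝕜)
    (hv : ∀ k, supPow Φ w p ({i | b i = k}.indicator v) ≤ 1) :
    ∃ T : EllP 𝕜 p →L[𝕜] SupSpace 𝕜 Φ w p, (∀ c i, toSeq (T c) i = c (b i) * v i) ∧ ‖T‖ ≤ 1 := by
  have h0 := coe_pos p
  have hle : ∀ c : EllP 𝕜 p, supPow Φ w p (fun i => c (b i) * v i)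
      ≤ ENNReal.ofReal (‖c‖ ^ (p : ℝ)) := by
    intro c
    refine iSup₂_le fun φ hφ => ?_
    have h1 : ∀ n, ‖c (b (φ n)) * v (φ n)‖ₑ ^ (p : ℝ) * ENNReal.ofReal (w n)
        = ∑' k, ‖c k‖ₑ ^ (p : ℝ) * (‖{i | b i = k}.indicator v (φ n)‖ₑ ^ (p : ℝ)
          * ENNReal.ofReal (w n)) := by
      intro n
      rw [tsum_eq_single (b (φ n))]
      · rw [Set.indicator_of_mem (show φ n ∈ {i | b i = b (φ n)} from rfl), enorm_mul,
          ENNReal.mul_rpow_of_nonneg _ _ h0.le, mul_assoc]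
      · intro k hk
        rw [Set.indicator_of_notMem (show φ n ∉ {i | b i = k} from fun h => hk h.symm)]
        simp [ENNReal.zero_rpow_of_pos h0]
    simp_rw [h1]
    -- With `φ` fixed, exchanging the sums over terms and blocks leaves, for each `k`, the factor
    -- `‖c k‖ ^ p` times a block sum that is at most `1`.
    rw [ENNReal.tsum_comm, ← EllP.tsum_enorm_rpow]
    refine ENNReal.tsum_le_tsum fun k => ?_
    rw [ENNReal.tsum_mul_left]
    exact mul_le_of_le_one_right' ((tsum_le_supPow _ hφ).trans (hv k))
  let T₀ : EllP 𝕜 p →ₗ[𝕜] SupSpace 𝕜 Φ w p :=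
    { toFun := fun c => mk (fun i => c (b i) * v i)
        ((supENorm_lt_top_iff hp.out _).2 ((hle c).trans_lt ENNReal.ofReal_lt_top))
      map_add' := fun c d => ext fun i => add_mul _ _ _
      map_smul' := fun r c => ext fun i => mul_assoc _ _ _ }
  have hT : ∀ c, ‖T₀ c‖ ≤ 1 * ‖c‖ := fun c => by
    rw [one_mul]
    exact (norm_le_iff (norm_nonneg _)).2 (hle c)
  exact ⟨T₀.mkContinuous 1 hT, fun _ _ => rfl, LinearMap.mkContinuous_norm_le _ zero_le_one _⟩

end SupSpace

/-- Jensen's inequality for the functional `f ↦ ∑ |y|^p w (f / y) / ∑ |y|^p w`, which norms `y` in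
a weighted `ℓ_p`-space. -/
theorem norm_sum_mul_div_rpow_le {𝕜 ι : Type*} [RCLike 𝕜] (s : Finset ι) (y f : ι → 𝕜) (w : ι → ℝ)
    (hw : ∀ j ∈ s, 0 ≤ w j) {q : ℝ} (hq : 1 ≤ q) (hσ : 0 < ∑ j ∈ s, ‖y j‖ ^ q * w j) :
    ‖∑ j ∈ s, ((‖y j‖ ^ q * w j / ∑ i ∈ s, ‖y i‖ ^ q * w i : ℝ) : 𝕜) * (f j / y j)‖ ^ q
      ≤ (∑ j ∈ s, ‖y j‖ ^ q * w j)⁻¹ * ∑ j ∈ s, ‖f j‖ ^ q * w j := by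
  set σ := ∑ j ∈ s, ‖y j‖ ^ q * w j
  have hμ : ∀ j ∈ s, 0 ≤ ‖y j‖ ^ q * w j / σ := fun j hj =>
    div_nonneg (mul_nonneg (by positivity) (hw j hj)) hσ.le
  have hμ1 : ∑ j ∈ s, ‖y j‖ ^ q * w j / σ = 1 := by
    rw [← Finset.sum_div]; exact div_self hσ.ne'
  have h1 : ‖∑ j ∈ s, ((‖y j‖ ^ q * w j / σ : ℝ) : 𝕜) * (f j / y j)‖
      ≤ ∑ j ∈ s, ‖y j‖ ^ q * w j / σ * ‖f j / y j‖ := by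
    refine (norm_sum_le _ _).trans (Finset.sum_le_sum fun j hj => ?_)
    rw [norm_mul, RCLike.norm_ofReal, abs_of_nonneg (hμ j hj)]
  refine (Real.rpow_le_rpow (norm_nonneg _) h1 (by linarith)).trans
    ((Real.rpow_arith_mean_le_arith_mean_rpow s _ _ hμ hμ1 (fun j _ => norm_nonneg _) hq).trans ?_)
  rw [Finset.mul_sum]
  refine Finset.sum_le_sum fun j hj => ?_
  rcases eq_or_ne (y j) 0 with h | h
  · rw [h, norm_zero, Real.zero_rpow (by linarith), zero_mul, zero_div, zero_mul]
    exact mul_nonneg (inv_nonneg.2 hσ.le) (mul_nonneg (by positivity) (hw j hj))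
  · have : 0 < ‖y j‖ ^ q := Real.rpow_pos_of_pos (norm_pos_iff.2 h) _
    rw [norm_div, Real.div_rpow (norm_nonneg _) (norm_nonneg _)]
    refine le_of_eq ?_
    field_simp

namespace Garling

open SupSpace

variable {𝕜 : Type*} [RCLike 𝕜] {w : Weight} {p : ℝ≥0} [hp : Fact (1 ≤ p)]

/-- One step of the gliding hump construction. -/
theorem exists_hump (x : ℕ → Garling 𝕜 w p) (hx1 : ∀ n, ‖x n‖ = 1)
    (hsup : ∀ δ : ℝ, 0 < δ → ∀ᶠ n in atTop, ∀ i, ‖toSeq (x n) i‖ ≤ δ) {η θ : ℝ} (hη : 0 < η)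
    (hθ : 0 < θ) (N n : ℕ) :
    ∃ n' N' m : ℕ, ∃ φ : ℕ → ℕ, n < n' ∧ N < N' ∧ N < m ∧ m ≤ N' ∧ StrictMono φ ∧
      (∀ j < m, φ j < N') ∧
      1 - 2 * η < ∑ j ∈ Finset.Ico N m, ‖toSeq (x n') (φ j)‖ ^ (p : ℝ) * w j ∧
      ‖x n' - restrict 𝕜 increasingMaps w p (Set.Ico N N') (x n')‖ ≤ θ := by
  have h0 := coe_pos p
  have h1p : (1 : ℝ) ≤ p := by exact_mod_cast hp.out
  -- Small enough that `N` coordinates of size `δ` cost at most `η` in a weighted sum and at most `θ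
  -- / 2` in norm; `δ ≤ 1` is needed for `δ ^ p ≤ δ`.
  set δ : ℝ := min 1 (min (η / (N + 1)) (θ / (2 * (N + 1)))) with hδ
  have hN0 : (0 : ℝ) < N + 1 := by positivity
  have hδ0 : 0 < δ := by positivity
  have hδη : N * δ ≤ η := by
    have : δ ≤ η / (N + 1) := (min_le_right _ _).trans (min_le_left _ _)
    rw [le_div_iff₀ hN0] at this
    nlinarith
  have hδθ : N * δ ≤ θ / 2 := by
    have : δ ≤ θ / (2 * (N + 1)) := (min_le_right _ _).trans (min_le_right _ _)
    rw [le_div_iff₀ (by positivity)] at this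
    nlinarith
  obtain ⟨n', hn', hsm⟩ := ((eventually_gt_atTop n).and (hsup δ hδ0)).exists
  set f := x n' with hf
  obtain ⟨φ, hφ, m₀, hm₀⟩ := exists_lt_sum f (c := 1 - η) (by rw [hx1, Real.one_rpow]; linarith)
  obtain ⟨N₀, hN₀⟩ := Metric.tendsto_atTop.1 (tendsto_tail f) (θ / 2) (by positivity)
  set m := max m₀ (N + 1) with hm
  set N' := max N₀ (max m (φ m)) with hN'
  have hNm : N < m := by omega
  refine ⟨n', N', m, φ, hn', by omega, hNm, by omega, hφ, fun j hj => ?_, ?_, ?_⟩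
  · have := hφ hj
    omega
  -- One `η` is lost by the choice of `φ`, another by discarding the weight indices below `N`. For
  -- `j ≥ N` also `φ j ≥ N`, so the rest of the sum reads coordinates inside the block.
  · have e1 : ∑ j ∈ Finset.range m₀, ‖toSeq f (φ j)‖ ^ (p : ℝ) * w j
        ≤ ∑ j ∈ Finset.range m, ‖toSeq f (φ j)‖ ^ (p : ℝ) * w j :=
      Finset.sum_le_sum_of_subset_of_nonneg (Finset.range_mono (le_max_left _ _))
        fun j _ _ => term_nonneg f _ j
    rw [← Finset.sum_range_add_sum_Ico _ hNm.le] at e1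
    have e2 : ∑ j ∈ Finset.range N, ‖toSeq f (φ j)‖ ^ (p : ℝ) * w j ≤ N * δ := by
      have : ∀ j ∈ Finset.range N, ‖toSeq f (φ j)‖ ^ (p : ℝ) * w j ≤ δ := fun j _ => by
        have hw1 : w j ≤ 1 := by simpa [w.zero_eq_one] using w.antitone (Nat.zero_le j)
        refine (mul_le_of_le_one_right (by positivity) hw1).trans ?_
        refine (Real.rpow_le_rpow (norm_nonneg _) (hsm _) h0.le).trans ?_
        simpa using Real.rpow_le_rpow_of_exponent_ge hδ0 (min_le_left _ _) h1p
      simpa using Finset.sum_le_sum this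
    linarith
  · have e1 : f - restrict 𝕜 increasingMaps w p (Set.Ico N N') f
        = ∑ i ∈ Finset.range N, toSeq f i • garlingUnit 𝕜 w p i
          + restrict 𝕜 increasingMaps w p (Set.Ici N') f := by
      rw [sum_smul_unitVector]
      ext i
      have hNN : N < N' := by omega
      by_cases h1 : i < N
      · simp [h1, h1.not_ge, (h1.trans hNN).not_ge]
      · by_cases h2 : i < N'
        · simp [h1, h2, not_lt.1 h1]
        · simp [h1, h2, not_lt.1 h2]
    rw [e1]
    refine (norm_add_le _ _).trans ?_
    have e2 : ‖restrict 𝕜 increasingMaps w p (Set.Ici N') f‖ < θ / 2 := by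
      simpa using hN₀ N' (by omega)
    have e3 : ‖∑ i ∈ Finset.range N, toSeq f i • garlingUnit 𝕜 w p i‖ ≤ N * δ := by
      refine (norm_sum_le _ _).trans ?_
      have : ∀ i ∈ Finset.range N, ‖toSeq f i • garlingUnit 𝕜 w p i‖ ≤ δ := fun i _ => by
        rw [norm_smul]
        have : ‖garlingUnit 𝕜 w p i‖ ≤ 1 := norm_unitVector_le i
        exact (mul_le_of_le_one_right (norm_nonneg _) this).trans (hsm i)
      simpa using Finset.sum_le_sum this
    linarith

end Garling

namespace Garling

open SupSpace

variable {𝕜 : Type*} [RCLike 𝕜] {w : Weight} {p : ℝ≥0} [hp : Fact (1 ≤ p)]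

/-- A normalized sequence whose coordinates tend uniformly to `0` has a subsequence which is almost
isometrically equivalent to the basis of `ℓ_p` and spans an almost norm one complemented
subspace. -/
theorem exists_ellP_factorization (x : ℕ → Garling 𝕜 w p) (hx1 : ∀ n, ‖x n‖ = 1)
    (hsup : ∀ δ : ℝ, 0 < δ → ∀ᶠ n in atTop, ∀ i, ‖toSeq (x n) i‖ ≤ δ) {ε : ℝ} (hε : 0 < ε) :
    ∃ κ : ℕ → ℕ, StrictMono κ ∧ ∃ (T : EllP 𝕜 p →L[𝕜] Garling 𝕜 w p)
      (S : Garling 𝕜 w p →L[𝕜] EllP 𝕜 p), (∀ i, T (lp.single (p : ℝ≥0∞) i 1) = x (κ i)) ∧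
      S ∘L T = ContinuousLinearMap.id 𝕜 (EllP 𝕜 p) ∧ ‖T‖ * ‖S‖ ≤ 1 + ε := by
  have h0 := coe_pos p
  have h1p : (1 : ℝ) ≤ p := by exact_mod_cast hp.out
  -- The final norm product is at most `(1 + η) / (1 - 3 * η)`, which this choice keeps below `1 +
  -- ε`.
  set η : ℝ := ε / (8 * (1 + ε)) with hη
  have hη0 : 0 < η := by positivity
  have hηε : 8 * η + 8 * (η * ε) = ε := by rw [hη]; field_simp
  have hη8 : η < 1 / 8 := by
    rw [hη, div_lt_div_iff₀ (by positivity) (by norm_num)]; linarith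
  -- A state is a pair: the end of the coordinates used so far, and the index of the last vector
  -- chosen. The errors `η / 2 / 2 ^ k` sum to `η`.
  obtain ⟨u, hu0, hu⟩ := exists_seq_step (fun (k : ℕ) (s t : ℕ × ℕ) => ∃ m : ℕ, ∃ φ : ℕ → ℕ,
      s.2 < t.2 ∧ s.1 < t.1 ∧ s.1 < m ∧ m ≤ t.1 ∧ StrictMono φ ∧ (∀ j < m, φ j < t.1) ∧
      1 - 2 * η < ∑ j ∈ Finset.Ico s.1 m, ‖toSeq (x t.2) (φ j)‖ ^ (p : ℝ) * w j ∧
      ‖x t.2 - restrict 𝕜 increasingMaps w p (Set.Ico s.1 t.1) (x t.2)‖ ≤ η / 2 / 2 ^ k)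
    (fun k s => by
      obtain ⟨n', N', h⟩ := exists_hump x hx1 hsup hη0 (show 0 < η / 2 / 2 ^ k by positivity) s.1 s.2
      exact ⟨(N', n'), h⟩) (0, 0)
  choose m φ hn hN hNm hmN hφ hφlt hσ herr using hu
  set N : ℕ → ℕ := fun k => (u k).1
  set κ : ℕ → ℕ := fun k => (u (k + 1)).2
  have hNmono : StrictMono N := strictMono_nat_of_lt_succ hN
  have hκ : StrictMono κ := strictMono_nat_of_lt_succ fun k => hn (k + 1)
  obtain ⟨b, hb⟩ := exists_block_index hNmono (by simp [N, hu0])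
  set v : ℕ → 𝕜 := fun i => toSeq (x (κ (b i))) i
  have hind : ∀ k, {i | b i = k}.indicator v
      = toSeq (restrict 𝕜 increasingMaps w p (Set.Ico (N k) (N (k + 1))) (x (κ k))) := by
    intro k
    funext i
    by_cases h : b i = k
    · rw [toSeq_restrict, Set.indicator_of_mem (show i ∈ {i | b i = k} from h),
        Set.indicator_of_mem (show i ∈ Set.Ico (N k) (N (k + 1)) from (hb i k).1 h)]
      simp [v, h]
    · rw [toSeq_restrict, Set.indicator_of_notMem (show i ∉ {i | b i = k} from h),
        Set.indicator_of_notMem (show i ∉ Set.Ico (N k) (N (k + 1)) from fun h' => h ((hb i k).2 h'))]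
  obtain ⟨T₀, hT₀, hT₀n⟩ := exists_blockOperator (Φ := increasingMaps) (w := w) (p := p) b v
    (fun k => by
      rw [hind, supPow_toSeq, ENNReal.ofReal_le_one]
      exact Real.rpow_le_one (norm_nonneg _) ((norm_restrict_le _ _).trans (hx1 _).le) h0.le)
  set err : ℕ → Garling 𝕜 w p := fun k =>
    x (κ k) - restrict 𝕜 increasingMaps w p (Set.Ico (N k) (N (k + 1))) (x (κ k))
  have hgeo := hasSum_geometric_two' η
  have hsum : Summable fun k => ‖err k‖ :=
    Summable.of_nonneg_of_le (fun _ => norm_nonneg _) herr hgeo.summable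
  obtain ⟨R, hR, hRn⟩ := exists_clm_of_summable (EllP.coord 𝕜 p) EllP.norm_coord_le err hsum
    ((Summable.tsum_le_tsum herr hsum hgeo.summable).trans_eq hgeo.tsum_eq)
  set y : ℕ → ℕ → 𝕜 := fun k j => toSeq (x (κ k)) (φ k j)
  set σ : ℕ → ℝ := fun k => ∑ j ∈ Finset.Ico (N k) (m k), ‖y k j‖ ^ (p : ℝ) * w j
  have hσ' : ∀ k, 1 - 2 * η < σ k := hσ
  have hσ0 : ∀ k, 0 < σ k := fun k => by linarith [hσ' k]
  -- The norming functional of the `k`-th hump, normalized by `σ k` so that it takes the value `1`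
  -- there. It uses only the weight indices in `[N k, m k)`.
  set a : ℕ → Garling 𝕜 w p →ₗ[𝕜] 𝕜 := fun k => ∑ j ∈ Finset.Ico (N k) (m k),
    (((‖y k j‖ ^ (p : ℝ) * w j / σ k : ℝ) : 𝕜) / y k j) • (LinearMap.proj (φ k j)).comp toSeq
    with ha
  have ha' : ∀ k f, a k f = ∑ j ∈ Finset.Ico (N k) (m k),
      ((‖y k j‖ ^ (p : ℝ) * w j / σ k : ℝ) : 𝕜) * (toSeq f (φ k j) / y k j) := fun k f => by
    simp only [ha, LinearMap.sum_apply, LinearMap.smul_apply, LinearMap.comp_apply,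
      LinearMap.proj_apply, smul_eq_mul]
    exact Finset.sum_congr rfl fun j _ => by rw [div_mul_eq_mul_div, mul_div_assoc]
  have hbj : ∀ k j, j ∈ Finset.Ico (N k) (m k) → b j = k := fun k j hj => by
    rw [Finset.mem_Ico] at hj
    exact (hb j k).2 ⟨hj.1, hj.2.trans_le (hmN k)⟩
  have hbφ : ∀ k j, j ∈ Finset.Ico (N k) (m k) → b (φ k j) = k := fun k j hj => by
    rw [Finset.mem_Ico] at hj
    exact (hb _ k).2 ⟨hj.1.trans (hφ k).le_apply, hφlt k j hj.2⟩
  set C : ℝ := (1 - 2 * η)⁻¹ with hC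
  have hC1 : 1 ≤ C := (one_le_inv₀ (by linarith)).2 (by linarith)
  set J : Set ℕ := {j | j < m (b j)}
  set ψ : ℕ → ℕ := fun j => φ (b j) j
  have hmem : ∀ k j, j ∈ Finset.Ico (N k) (m k) → j ∈ J := fun k j hj => by
    change j < m (b j)
    rw [hbj k j hj]
    exact (Finset.mem_Ico.1 hj).2
  have hJ : J.Infinite := Set.infinite_of_injective_forall_mem hNmono.injective fun k =>
    hmem k _ (Finset.mem_Ico.2 ⟨le_rfl, hNm k⟩)
  -- The maps of the different humps glue: an earlier hump has `φ i < N (k + 1) ≤ j ≤ φ j` for every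
  -- weight index `j` of a later one.
  have hψ : StrictMonoOn ψ J := by
    intro i hi j hj hij
    rcases lt_trichotomy (b i) (b j) with h | h | h
    · have h1 := hφlt (b i) i hi
      have h2 := ((hb j (b j)).1 rfl).1
      have h3 := hNmono.monotone (show b i + 1 ≤ b j from h)
      have h4 : j ≤ φ (b j) j := (hφ (b j)).le_apply
      exact h1.trans_le (h3.trans (h2.trans h4))
    · simp only [ψ, h]
      exact hφ _ hij
    · have h1 := ((hb j (b j)).1 rfl).2
      have h2 := ((hb i (b i)).1 rfl).1
      have h3 := hNmono.monotone (show b j + 1 ≤ b i from h)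
      omega
  obtain ⟨S₀, hS₀, hS₀n⟩ := EllP.exists_clm_of_coord (p := p) a (by linarith : 0 ≤ C) (by
    intro f s
    calc ∑ k ∈ s, ‖a k f‖ ^ (p : ℝ)
        ≤ ∑ k ∈ s, C * ∑ j ∈ Finset.Ico (N k) (m k), ‖toSeq f (ψ j)‖ ^ (p : ℝ) * w j := by
          refine Finset.sum_le_sum fun k _ => ?_
          rw [ha']
          refine (norm_sum_mul_div_rpow_le _ (y k) (fun j => toSeq f (φ k j)) w
            (fun j _ => (w.pos j).le) h1p (hσ0 k)).trans ?_
          have : ∑ j ∈ Finset.Ico (N k) (m k), ‖toSeq f (φ k j)‖ ^ (p : ℝ) * w j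
              = ∑ j ∈ Finset.Ico (N k) (m k), ‖toSeq f (ψ j)‖ ^ (p : ℝ) * w j :=
            Finset.sum_congr rfl fun j hj => by simp only [ψ, hbj k j hj]
          rw [this]
          refine mul_le_mul_of_nonneg_right ?_ (Finset.sum_nonneg fun j _ => term_nonneg f _ j)
          exact inv_anti₀ (by linarith) (hσ' k).le
      _ = C * ∑ j ∈ s.biUnion fun k => Finset.Ico (N k) (m k), ‖toSeq f (ψ j)‖ ^ (p : ℝ) * w j := by
          rw [← Finset.mul_sum, Finset.sum_biUnion]
          intro k _ l _ hkl
          refine Finset.disjoint_left.2 fun j hj hj' => hkl ?_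
          rw [← hbj k j hj, ← hbj l j hj']
      _ ≤ C ^ (p : ℝ) * ‖f‖ ^ (p : ℝ) := by
          -- All humps together form one admissible sum, bounded by `‖f‖ ^ p`; `C ≤ C ^ p` because
          -- `1 ≤ C`.
          refine mul_le_mul (Real.self_le_rpow_of_one_le hC1 h1p)
            (sum_le_norm_rpow f hJ hψ fun j hj => ?_)
            (Finset.sum_nonneg fun j _ => term_nonneg f _ j) (by positivity)
          obtain ⟨k, -, hk⟩ := Finset.mem_biUnion.1 hj
          exact hmem k j hk
      _ = (C * ‖f‖) ^ (p : ℝ) := (Real.mul_rpow (by linarith) (norm_nonneg _)).symm)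
  have hST₀ : S₀ ∘L T₀ = ContinuousLinearMap.id 𝕜 (EllP 𝕜 p) := by
    refine ContinuousLinearMap.ext fun c => lp.ext (funext fun k => ?_)
    change S₀ (T₀ c) k = c k
    rw [hS₀, ha']
    have h1 : ∀ j ∈ Finset.Ico (N k) (m k),
        ((‖y k j‖ ^ (p : ℝ) * w j / σ k : ℝ) : 𝕜) * (toSeq (T₀ c) (φ k j) / y k j)
          = ((‖y k j‖ ^ (p : ℝ) * w j / σ k : ℝ) : 𝕜) * c k := fun j hj => by
      rcases eq_or_ne (y k j) 0 with h | h
      · simp [h, Real.zero_rpow h0.ne']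
      · have : toSeq (T₀ c) (φ k j) = c k * y k j := by
          rw [hT₀]
          simp only [v, y, hbφ k j hj]
        rw [this, mul_div_cancel_right₀ _ h]
    rw [Finset.sum_congr rfl h1, ← Finset.sum_mul, ← RCLike.ofReal_sum, ← Finset.sum_div,
      div_self (hσ0 k).ne', RCLike.ofReal_one, one_mul]
  have hT : ∀ i, (T₀ + R) (lp.single (p : ℝ≥0∞) i 1) = x (κ i) := by
    intro i
    have h1 : T₀ (lp.single (p : ℝ≥0∞) i 1)
        = restrict 𝕜 increasingMaps w p (Set.Ico (N i) (N (i + 1))) (x (κ i)) := by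
      refine toSeq_injective ?_
      rw [← hind]
      funext j
      rw [hT₀]
      by_cases h : b j = i
      · rw [Set.indicator_of_mem (show j ∈ {j | b j = i} from h), h, lp.single_apply_self, one_mul]
      · rw [Set.indicator_of_notMem (show j ∉ {j | b j = i} from h),
          lp.single_apply_ne _ _ _ h, zero_mul]
    have h2 : R (lp.single (p : ℝ≥0∞) i 1) = err i := by
      refine (hR _).unique ?_
      convert hasSum_single i fun l hl => ?_ using 1
      · rw [EllP.coord_apply, lp.single_apply_self, one_smul]
      · rw [EllP.coord_apply, lp.single_apply_ne _ _ _ hl, zero_smul]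
    rw [add_apply, h1, h2]
    exact add_sub_cancel _ _
  have hC0 : 0 < C := by linarith
  have hκ1 : C * η < 1 := by
    rw [hC, inv_mul_lt_iff₀ (by linarith)]; linarith
  -- `T₀` sends the basis to the humps and `R` restores the cut-off parts. Since `S₀` inverts `T₀`
  -- exactly, the defect is `S₀ ∘L R`, of norm at most `C * η`.
  obtain ⟨S, hS, hSn⟩ := exists_leftInverse_of_approx (T₀ + R) S₀ hκ1 (by
    have : S₀ ∘L (T₀ + R) - ContinuousLinearMap.id 𝕜 (EllP 𝕜 p) = S₀ ∘L R := by
      rw [ContinuousLinearMap.comp_add, hST₀, add_sub_cancel_left]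
    rw [this]
    exact (ContinuousLinearMap.opNorm_comp_le _ _).trans
      (mul_le_mul hS₀n hRn (norm_nonneg _) hC0.le))
  refine ⟨κ, hκ, T₀ + R, S, hT, hS, ?_⟩
  have hTn : ‖T₀ + R‖ ≤ 1 + η := (norm_add_le _ _).trans (add_le_add hT₀n hRn)
  have hSn' : ‖S‖ ≤ C / (1 - C * η) := hSn.trans (by
    have : 0 < 1 - C * η := by linarith
    gcongr)
  have e : C / (1 - C * η) = (1 - 3 * η)⁻¹ := by
    have h2 : C * (1 - 2 * η) = 1 := inv_mul_cancel₀ (by linarith)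
    have h3 : 1 - C * η = C * (1 - 3 * η) := by linarith
    rw [h3, div_mul_eq_div_div, div_self hC0.ne', one_div]
  rw [e] at hSn'
  refine (mul_le_mul hTn hSn' (norm_nonneg _) (by linarith)).trans ?_
  rw [← div_eq_mul_inv, div_le_iff₀ (by linarith)]
  nlinarith

end Garling

/-- The `i`-th smallest element of `s` is at least `i`, and the weights are nonincreasing. -/
theorem Weight.sum_le_sum_range (w : Weight) (s : Finset ℕ) :
    ∑ i ∈ s, w i ≤ ∑ i ∈ Finset.range s.card, w i := by
  rw [← Finset.sum_coe_sort s, ← (s.orderIsoOfFin rfl).toEquiv.sum_comp, Finset.sum_range]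
  refine Finset.sum_le_sum fun i _ => w.antitone ?_
  have hmono : StrictMono (s.orderEmbOfFin rfl) := (s.orderEmbOfFin rfl).strictMono
  have : ∀ n (h : n < s.card), n ≤ s.orderEmbOfFin rfl ⟨n, h⟩ := by
    intro n
    induction n with
    | zero => exact fun _ => Nat.zero_le _
    | succ n ih => exact fun h => (ih (by omega)).trans_lt (hmono (by simp))
  exact this i i.2

/-! ### Infinite-dimensional subspaces contain `ℓ_p` -/

namespace Garling

open SupSpace

variable {𝕜 : Type*} [RCLike 𝕜] {w : Weight} {p : ℝ≥0} [hp : Fact (1 ≤ p)]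

/-- The first `N` coordinates map `Y` to a finite-dimensional space, so the kernel is nontrivial. -/
theorem exists_vanishing_head (Y : Submodule 𝕜 (Garling 𝕜 w p)) (hY : ¬ FiniteDimensional 𝕜 Y)
    (N : ℕ) : ∃ x ∈ Y, ‖x‖ = 1 ∧ ∀ i < N, toSeq x i = 0 := by
  let L : Y →ₗ[𝕜] (Fin N → 𝕜) :=
    LinearMap.pi fun i => (LinearMap.proj (i : ℕ)).comp (toSeq.comp Y.subtype)
  have hL : ¬ Function.Injective L := fun h => hY (FiniteDimensional.of_injective L h)
  rw [← LinearMap.ker_eq_bot, Submodule.eq_bot_iff] at hL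
  push Not at hL
  obtain ⟨x, hx, hx0⟩ := hL
  have hx0' : (x : Garling 𝕜 w p) ≠ 0 := fun h => hx0 (Subtype.ext h)
  refine ⟨((‖(x : Garling 𝕜 w p)‖⁻¹ : ℝ) : 𝕜) • (x : Garling 𝕜 w p), Y.smul_mem _ x.2, ?_,
    fun i hi => ?_⟩
  · rw [norm_smul, RCLike.norm_ofReal, abs_of_nonneg (by positivity),
      inv_mul_cancel₀ (norm_ne_zero_iff.2 hx0')]
  · have : toSeq (x : Garling 𝕜 w p) i = 0 := congrFun (show L x = 0 from hx) ⟨i, hi⟩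
    simp [this]

/-- Infinite-dimensional subspaces contain normalized vectors with small coordinates. -/
theorem exists_small_sup (Y : Submodule 𝕜 (Garling 𝕜 w p)) (hY : ¬ FiniteDimensional 𝕜 Y)
    {δ : ℝ} (hδ : 0 < δ) : ∃ x ∈ Y, ‖x‖ = 1 ∧ ∀ i, ‖toSeq x i‖ ≤ δ := by
  by_contra! hcon
  have h0 := coe_pos p
  -- Assuming every unit vector of `Y` has a coordinate above `δ`, a sum of `m` almost disjoint ones
  -- has `m` coordinates near `δ` or more, yet all coordinates stay near `1` or less.
  have step : ∀ (η : ℝ), 0 < η → ∀ m : ℕ, ∃ z ∈ Y, ∃ N, ∃ φ : ℕ → ℕ, StrictMono φ ∧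
      (∀ j < m, φ j < N ∧ δ - m * η ≤ ‖toSeq z (φ j)‖) ∧ (∀ i, ‖toSeq z i‖ ≤ 1 + m * η) ∧
      ∀ i, N ≤ i → ‖toSeq z i‖ ≤ m * η := by
    intro η hη m
    induction m with
    | zero => exact ⟨0, Y.zero_mem, 0, id, strictMono_id, by simp, by simp, by simp⟩
    | succ m ih =>
      obtain ⟨z, hz, N, φ, hφ, h1, h2, h3⟩ := ih
      obtain ⟨x, hx, hx1, hx0⟩ := exists_vanishing_head Y hY N
      obtain ⟨i₀, hi₀⟩ := hcon x hx hx1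
      have hNi : N ≤ i₀ := by
        by_contra h
        rw [hx0 i₀ (by omega), norm_zero] at hi₀
        linarith
      obtain ⟨N₀, hN₀⟩ := Metric.tendsto_atTop.1 (tendsto_apply_zero x) η hη
      simp only [dist_zero_right] at hN₀
      have hxle : ∀ i, ‖toSeq x i‖ ≤ 1 := fun i => (norm_apply_le x i).trans hx1.le
      -- Only the values of the map up to `m` matter; `i₀ + (j - m)` merely continues it
      -- increasingly.
      refine ⟨z + x, Y.add_mem hz hx, max N₀ (i₀ + 1), fun j => if j < m then φ j else i₀ + (j - m),
        ?_, ?_, ?_, ?_⟩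
      · intro a b hab
        by_cases ha : a < m <;> by_cases hb : b < m
        · simp only [ha, hb, if_true]; exact hφ hab
        · simp only [ha, hb, if_true, if_false]; have := (h1 a ha).1; omega
        · omega
        · simp only [ha, hb, if_false]; omega
      · intro j hj
        push_cast
        by_cases hjm : j < m
        · obtain ⟨h4, h5⟩ := h1 j hjm
          simp only [hjm, if_true]
          refine ⟨by omega, ?_⟩
          rw [map_add, Pi.add_apply, hx0 _ h4, add_zero]
          linarith
        · have hjm' : j = m := by omega
          subst hjm'
          simp only [lt_irrefl, if_false, Nat.sub_self, add_zero]
          refine ⟨by omega, ?_⟩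
          have h4 := norm_sub_norm_le (toSeq x i₀) (-toSeq z i₀)
          rw [norm_neg, sub_neg_eq_add, add_comm (toSeq x i₀)] at h4
          have h5 := h3 i₀ hNi
          rw [map_add, Pi.add_apply]
          linarith
      · intro i
        push_cast
        rw [map_add, Pi.add_apply]
        by_cases hi : i < N
        · rw [hx0 i hi, add_zero]; linarith [h2 i]
        · linarith [norm_add_le (toSeq z i) (toSeq x i), h3 i (by omega), hxle i]
      · intro i hi
        push_cast
        rw [map_add, Pi.add_apply]
        linarith [norm_add_le (toSeq z i) (toSeq x i), h3 i (by omega), hN₀ i (by omega)]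
  -- Since the coordinates of `z` are at most `1 + δ / 2`, norm `K` suffices for `z / ‖z‖` to have
  -- all coordinates at most `δ`, a contradiction. Divergence of `∑ w n` makes the norm that large.
  set K : ℝ := (1 + δ / 2) / δ with hK
  have hK0 : 0 < K := by positivity
  obtain ⟨m, hm⟩ := ((tendsto_atTop.1 w.sum_range_tendsto)
    (K ^ (p : ℝ) / (δ / 2) ^ (p : ℝ))).exists
  have hm0 : (0 : ℝ) < m + 1 := by positivity
  obtain ⟨z, hz, N, φ, hφ, h1, h2, -⟩ := step (δ / (2 * (m + 1))) (by positivity) m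
  have hmη : m * (δ / (2 * (m + 1))) ≤ δ / 2 := by
    rw [← mul_div_assoc, div_le_div_iff₀ (by positivity) (by positivity)]
    nlinarith
  have h3 : K ≤ ‖z‖ := by
    rw [← Real.rpow_le_rpow_iff hK0.le (norm_nonneg _) h0]
    refine le_trans ?_ (sum_le_norm_rpow_of_strictMono z hφ (Finset.range m))
    rw [div_le_iff₀ (by positivity), mul_comm] at hm
    refine hm.trans ?_
    rw [Finset.mul_sum]
    refine Finset.sum_le_sum fun j hj => mul_le_mul_of_nonneg_right ?_ (w.pos j).le
    exact Real.rpow_le_rpow (by positivity)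
      (by linarith [(h1 j (Finset.mem_range.1 hj)).2]) h0.le
  have hz0 : 0 < ‖z‖ := hK0.trans_le h3
  obtain ⟨i, hi⟩ := hcon (((‖z‖⁻¹ : ℝ) : 𝕜) • z) (Y.smul_mem _ hz) (by
    rw [norm_smul, RCLike.norm_ofReal, abs_of_nonneg (by positivity), inv_mul_cancel₀ hz0.ne'])
  rw [map_smul, Pi.smul_apply, norm_smul, RCLike.norm_ofReal, abs_of_nonneg (by positivity),
    lt_inv_mul_iff₀ hz0] at hi
  have h4 : K * δ = 1 + δ / 2 := by rw [hK]; field_simp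
  nlinarith [h2 i]

/-- Every infinite-dimensional closed subspace contains almost isometric, almost norm one
complemented copies of `ℓ_p`. -/
theorem exists_complemented_ellP {ε : ℝ} (hε : 0 < ε) (Y : Submodule 𝕜 (Garling 𝕜 w p))
    (hYc : IsClosed (Y : Set (Garling 𝕜 w p))) (hY : ¬ FiniteDimensional 𝕜 Y) :
    ∃ Z : Submodule 𝕜 (Garling 𝕜 w p), Z ≤ Y ∧ IsClosed (Z : Set (Garling 𝕜 w p)) ∧
      IsIsomorphicWith 𝕜 Z (EllP 𝕜 p) (1 + ε) ∧ IsComplementedWith (1 + ε) Z := by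
  choose x hxY hx1 hx using fun n : ℕ =>
    exists_small_sup Y hY (δ := 1 / (n + 1)) Nat.one_div_pos_of_nat
  obtain ⟨κ, -, T, S, hT, hST, hn⟩ := exists_ellP_factorization x hx1 (fun δ hδ => by
    filter_upwards [(tendsto_one_div_add_atTop_nhds_zero_nat (𝕜 := ℝ)).eventually (gt_mem_nhds hδ)]
      with n hn i
    exact (hx n i).trans hn.le) hε
  refine ⟨LinearMap.range (T : EllP 𝕜 p →ₗ[𝕜] Garling 𝕜 w p), ?_, isClosed_range_of_leftInverse hST,
    ?_, ?_⟩
  · rw [← closedSpan_eq_range_of_leftInverse hST EllP.closedSpan_single (y := x ∘ κ)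
      (c := fun _ => 1) (fun _ => one_ne_zero) (fun i => by rw [hT, one_smul]; rfl)]
    refine Submodule.topologicalClosure_minimal _ ?_ hYc
    rw [Submodule.span_le]
    rintro _ ⟨i, rfl⟩
    exact hxY _
  · obtain ⟨e, he⟩ := isIsomorphicWith_range hST
    exact ⟨e, he.trans hn⟩
  · obtain ⟨P, hP, hPn⟩ := isComplementedWith_range hST
    exact ⟨P, hP, hPn.trans hn⟩

end Garling

/-! ### The inclusion of the Lorentz space fixes a copy of `ℓ_p` -/

open SupSpace in
/-- The identity of `ℓ_p` factors through the inclusion of `d(w,p)` into `g(w,p)`. -/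
theorem exists_factorization_lorentzInclusion (𝕜 : Type*) [RCLike 𝕜] (w : Weight) (p : ℝ≥0)
    [hp : Fact (1 ≤ p)] :
    ∃ (T : EllP 𝕜 p →L[𝕜] Lorentz 𝕜 w p) (S : Garling 𝕜 w p →L[𝕜] EllP 𝕜 p),
      S ∘L lorentzInclusion 𝕜 w p ∘L T = ContinuousLinearMap.id 𝕜 (EllP 𝕜 p) := by
  have h0 := coe_pos p
  set W : ℕ → ℝ := fun n => ∑ i ∈ Finset.range n, w i with hW
  have hWpos : ∀ n, 0 < W (n + 1) := fun n =>
    Finset.sum_pos (fun i _ => w.pos i) (by simp)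
  -- Block `k` has length `k + 1` and constant coefficient `W (k + 1) ^ (-1/p)`: it is normalized in
  -- both spaces, and the coefficients tend to `0`.
  set N : ℕ → ℕ := fun n => ∑ i ∈ Finset.range n, (i + 1)
  have hNs : ∀ n, N (n + 1) = N n + (n + 1) := fun n => Finset.sum_range_succ _ _
  obtain ⟨b, hb⟩ := exists_block_index (N := N)
    (strictMono_nat_of_lt_succ fun n => by rw [hNs]; omega) (by simp [N])
  set v : ℕ → 𝕜 := fun i => (((W (b i + 1))⁻¹ ^ (p : ℝ)⁻¹ : ℝ) : 𝕜)
  have hvn : ∀ i, ‖v i‖ = (W (b i + 1))⁻¹ ^ (p : ℝ)⁻¹ := fun i => by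
    have := hWpos (b i)
    rw [RCLike.norm_ofReal, abs_of_nonneg (by positivity)]
  have hvp : ∀ i, ‖v i‖ ^ (p : ℝ) = (W (b i + 1))⁻¹ := fun i => by
    rw [hvn, Real.rpow_inv_rpow (inv_nonneg.2 (hWpos _).le) h0.ne']
  have hd : ∀ k, supPow permutationMaps w p ({i | b i = k}.indicator v) ≤ 1 := by
    intro k
    rw [supPow_le_iff]
    intro σ hσ M
    have h1 : ∀ n, ‖{i | b i = k}.indicator v (σ n)‖ₑ ^ (p : ℝ) * ENNReal.ofReal (w n)
        = ENNReal.ofReal (if b (σ n) = k then (W (k + 1))⁻¹ * w n else 0) := by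
      intro n
      by_cases h : b (σ n) = k
      · rw [Set.indicator_of_mem (show σ n ∈ {i | b i = k} from h), if_pos h,
          ← ofReal_norm, ENNReal.ofReal_rpow_of_nonneg (norm_nonneg _) h0.le, hvp, h,
          ENNReal.ofReal_mul (inv_nonneg.2 (hWpos _).le)]
      · rw [Set.indicator_of_notMem (show σ n ∉ {i | b i = k} from h), if_neg h]
        simp [ENNReal.zero_rpow_of_pos h0]
    have hnn : ∀ n, 0 ≤ if b (σ n) = k then (W (k + 1))⁻¹ * w n else 0 := fun n => by
      split_ifs
      · exact mul_nonneg (inv_nonneg.2 (hWpos _).le) (w.pos n).le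
      · exact le_rfl
    simp_rw [h1]
    rw [← ENNReal.ofReal_sum_of_nonneg fun n _ => hnn n, ENNReal.ofReal_le_one,
      ← Finset.sum_filter, ← Finset.mul_sum, inv_mul_le_iff₀ (hWpos k), mul_one]
    refine (w.sum_le_sum_range _).trans (Finset.sum_le_sum_of_subset_of_nonneg
      (Finset.range_mono ?_) fun i _ _ => (w.pos i).le)
    -- A permutation meets the block at most `k + 1` times, so the weights collected total at most
    -- `W (k + 1)`.
    have h2 : (Finset.filter (fun n => b (σ n) = k) (Finset.range M)).card
        ≤ (Finset.Ico (N k) (N (k + 1))).card := by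
      refine Finset.card_le_card_of_injOn σ (fun n hn => ?_) hσ.1.injOn
      simp only [Finset.coe_filter, Set.mem_ofPred_eq] at hn
      simpa using (hb _ k).1 hn.2
    rw [Nat.card_Ico, hNs] at h2
    omega
  have hg : ∀ k, supPow increasingMaps w p ({i | b i = k}.indicator v) ≤ 1 := fun k => by
    refine le_trans ?_ (hd k)
    rw [← supENorm_rpow hp.out, ← supENorm_rpow hp.out]
    exact ENNReal.rpow_le_rpow (supENorm_increasing_le_permutation w p _) h0.le
  choose x hx hx1 using fun k => exists_of_supPow_le (Φ := increasingMaps) (w := w) (p := p)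
    zero_le_one (by rw [Real.one_rpow, ENNReal.ofReal_one]; exact hg k)
  have hx1' : ∀ k, ‖x k‖ = 1 := by
    intro k
    refine le_antisymm (hx1 k) ?_
    rw [← Real.rpow_le_rpow_iff zero_le_one (norm_nonneg _) h0, Real.one_rpow]
    refine le_trans (le_of_eq ?_) (Garling.sum_le_norm_rpow_of_strictMono (x k)
      (φ := fun j => N k + j) (fun i j h => by simpa using h) (Finset.range (k + 1)))
    have : ∀ j ∈ Finset.range (k + 1), ‖toSeq (x k) (N k + j)‖ ^ (p : ℝ) * w j
        = (W (k + 1))⁻¹ * w j := fun j hj => by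
      have hbj : b (N k + j) = k := (hb _ k).2 ⟨by omega, by
        rw [hNs]; have := Finset.mem_range.1 hj; omega⟩
      rw [hx, Set.indicator_of_mem (show N k + j ∈ {i | b i = k} from hbj), hvp, hbj]
    rw [Finset.sum_congr rfl this, ← Finset.mul_sum, inv_mul_cancel₀ (hWpos k).ne']
  have hlim : Tendsto (fun k => (W (k + 1))⁻¹ ^ (p : ℝ)⁻¹) atTop (𝓝 0) := by
    have h1 : Tendsto (fun k => (W (k + 1))⁻¹) atTop (𝓝 0) :=
      (w.sum_range_tendsto.comp (tendsto_add_atTop_nat 1)).inv_tendsto_atTop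
    simpa [Real.zero_rpow (inv_ne_zero h0.ne')] using
      h1.rpow_const (p := (p : ℝ)⁻¹) (Or.inr (inv_nonneg.2 h0.le))
  obtain ⟨κ, hκ, T, S, hT, hST, -⟩ := Garling.exists_ellP_factorization x hx1' (fun δ hδ => by
    filter_upwards [hlim.eventually (gt_mem_nhds hδ)] with k hk i
    rw [hx]
    by_cases h : b i = k
    · rw [Set.indicator_of_mem (show i ∈ {i | b i = k} from h), hvn, h]
      exact hk.le
    · rw [Set.indicator_of_notMem (show i ∉ {i | b i = k} from h), norm_zero]
      exact hδ.le) one_pos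
  classical
  -- Renumbering of the selected blocks. On the discarded ones `b'` is arbitrary, which is harmless
  -- since `v'` vanishes there.
  set b' : ℕ → ℕ := fun i => Function.invFun κ (b i)
  set v' : ℕ → 𝕜 := fun i => if b i ∈ Set.range κ then v i else 0
  have hind : ∀ k, {i | b' i = k}.indicator v' = {i | b i = κ k}.indicator v := by
    intro k
    funext i
    by_cases h : b i ∈ Set.range κ
    · obtain ⟨l, hl⟩ := h
      have hb' : b' i = l := by
        simp only [b', ← hl, Function.leftInverse_invFun hκ.injective l]
      by_cases hlk : l = k
      · rw [Set.indicator_of_mem (show i ∈ {i | b' i = k} from hb'.trans hlk),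
          Set.indicator_of_mem (show i ∈ {i | b i = κ k} from by rw [← hlk]; exact hl.symm)]
        exact if_pos ⟨l, hl⟩
      · rw [Set.indicator_of_notMem (show i ∉ {i | b' i = k} from fun h => hlk (hb'.symm.trans h)),
          Set.indicator_of_notMem (show i ∉ {i | b i = κ k} from fun h =>
            hlk (hκ.injective (hl.trans h)))]
    · rw [Set.indicator_of_notMem (show i ∉ {i | b i = κ k} from fun h' => h ⟨k, h'.symm⟩)]
      by_cases h' : b' i = k
      · rw [Set.indicator_of_mem (show i ∈ {i | b' i = k} from h')]
        exact if_neg h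
      · rw [Set.indicator_of_notMem (show i ∉ {i | b' i = k} from h')]
  obtain ⟨T', hT', -⟩ := exists_blockOperator (Φ := permutationMaps) (w := w) (p := p) b' v'
    (fun k => by rw [hind]; exact hd _)
  refine ⟨T', S, ?_⟩
  -- The upper `p`-estimate in the Lorentz space lifts `T`: both operators send the basis vectors to
  -- the same blocks.
  have : lorentzInclusion 𝕜 w p ∘L T' = T := by
    refine ContinuousLinearMap.ext_on (s := Set.range fun i =>
      (lp.single (p : ℝ≥0∞) i (1 : 𝕜) : EllP 𝕜 p)) ?_ ?_
    · have := EllP.closedSpan_single (𝕜 := 𝕜) (p := p)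
      exact Submodule.dense_iff_topologicalClosure_eq_top.2 this
    · rintro _ ⟨i, rfl⟩
      rw [hT]
      refine toSeq_injective ?_
      rw [hx, ← hind]
      funext j
      change toSeq (T' _) j = _
      rw [hT']
      by_cases h : b' j = i
      · rw [Set.indicator_of_mem (show j ∈ {j | b' j = i} from h), h, lp.single_apply_self, one_mul]
      · rw [Set.indicator_of_notMem (show j ∉ {j | b' j = i} from h),
          lp.single_apply_ne _ _ _ h, zero_mul]
  rw [this, hST]

/-! ### Reflexivity -/

/-- A cluster point of a bounded sequence in the bidual. -/
theorem exists_bidual_limit {𝕜 X : Type*} [RCLike 𝕜] [NormedAddCommGroup X] [NormedSpace 𝕜 X]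
    (x : ℕ → X) {B : ℝ} (hx : ∀ n, ‖x n‖ ≤ B) :
    ∃ Λ : StrongDual 𝕜 (StrongDual 𝕜 X), ∀ (h : StrongDual 𝕜 X) (a : 𝕜),
      Tendsto (fun n => h (x n)) atTop (𝓝 a) → Λ h = a := by
  have hle : (hyperfilter ℕ : Filter ℕ) ≤ atTop := Nat.hyperfilter_le_atTop
  -- Limits along a free ultrafilter exist by compactness of balls in `𝕜`; uniqueness of limits
  -- makes them linear in `h`.
  have hex : ∀ h : StrongDual 𝕜 X, ∃ a : 𝕜, ‖a‖ ≤ B * ‖h‖ ∧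
      Tendsto (fun n => h (x n)) (hyperfilter ℕ) (𝓝 a) := by
    intro h
    have hmem : ∀ n, h (x n) ∈ Metric.closedBall (0 : 𝕜) (B * ‖h‖) := fun n => by
      rw [mem_closedBall_zero_iff, mul_comm]
      exact (h.le_opNorm _).trans (by gcongr; exact hx n)
    obtain ⟨a, ha, hle⟩ := (isCompact_closedBall (0 : 𝕜) (B * ‖h‖)).ultrafilter_le_nhds'
      ((hyperfilter ℕ).map fun n => h (x n)) (Filter.mem_map.2 (Filter.univ_mem' hmem))
    exact ⟨a, mem_closedBall_zero_iff.1 ha, hle⟩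
  choose Λ hΛ hlim using hex
  let L : StrongDual 𝕜 X →ₗ[𝕜] 𝕜 :=
    { toFun := Λ
      map_add' := fun g h => tendsto_nhds_unique (hlim (g + h)) ((hlim g).add (hlim h))
      map_smul' := fun c h => tendsto_nhds_unique (hlim (c • h)) ((hlim h).const_smul c) }
  exact ⟨L.mkContinuous B hΛ, fun h a ha => tendsto_nhds_unique (hlim h) (ha.mono_left hle)⟩

/-- The summation functional on `ℓ_1`. -/
theorem EllP.exists_sum_functional (𝕜 : Type*) [RCLike 𝕜] [Fact ((1 : ℝ≥0) ≤ 1)] :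
    ∃ σ : EllP 𝕜 1 →L[𝕜] 𝕜, ∀ f : EllP 𝕜 1, HasSum (fun k => f k) (σ f) := by
  have hs : ∀ f : EllP 𝕜 1, Summable fun k => ‖f k‖ := fun f => by
    simpa using (lp.memℓp f).summable (EllP.toReal_pos 1)
  have hn : ∀ f : EllP 𝕜 1, ‖f‖ = ∑' k, ‖f k‖ := fun f => by
    simpa using lp.norm_rpow_eq_tsum (EllP.toReal_pos 1) f
  let L : EllP 𝕜 1 →ₗ[𝕜] 𝕜 :=
    { toFun := fun f => ∑' k, f k
      map_add' := fun f g => (hs f).of_norm.tsum_add (hs g).of_norm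
      map_smul' := fun c f => (hs f).of_norm.tsum_const_smul c }
  refine ⟨L.mkContinuous 1 fun f => ?_, fun f => (hs f).of_norm.hasSum⟩
  rw [one_mul, hn]
  exact norm_tsum_le_tsum_norm (hs f)

/-- A bidual cluster point of `T (e n)`, if given by some `x`, would make all coordinates of `S x`
zero, while the summation functional, equal to `1` on every `e n`, would be `1` at `S x`. -/
theorem not_isReflexive_of_ellOne {𝕜 X : Type*} [RCLike 𝕜] [NormedAddCommGroup X]
    [NormedSpace 𝕜 X] [Fact ((1 : ℝ≥0) ≤ 1)] (T : EllP 𝕜 1 →L[𝕜] X) (S : X →L[𝕜] EllP 𝕜 1)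
    (h : S ∘L T = ContinuousLinearMap.id 𝕜 (EllP 𝕜 1)) : ¬ IsReflexive 𝕜 X := by
  intro hrefl
  have hST : ∀ y, S (T y) = y := DFunLike.congr_fun h
  set e : ℕ → EllP 𝕜 1 := fun n => lp.single ((1 : ℝ≥0) : ℝ≥0∞) n 1
  have he : ∀ n, ‖T (e n)‖ ≤ ‖T‖ := fun n => by
    have : ‖e n‖ = 1 := by
      rw [lp.norm_single (zero_lt_one.trans_le (fact_one_le_coe 1).out), norm_one]
    simpa [this] using T.le_opNorm (e n)
  obtain ⟨Λ, hΛ⟩ := exists_bidual_limit (𝕜 := 𝕜) (fun n => T (e n)) he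
  obtain ⟨x, hx⟩ := hrefl Λ
  have hx' : ∀ g : StrongDual 𝕜 X, Λ g = g x := fun g => by
    rw [← hx, NormedSpace.dual_def]
  have hSx : S x = 0 := by
    refine lp.ext (funext fun k => ?_)
    have := hΛ (EllP.coord 𝕜 1 k ∘L S) 0 (by
      refine tendsto_const_nhds.congr' ((eventually_gt_atTop k).mono fun n hn => ?_)
      change 0 = (S (T (e n))) k
      rw [hST]
      exact (lp.single_apply_ne (E := fun _ : ℕ => 𝕜) _ n 1 hn.ne).symm)
    rw [hx'] at this
    exact this
  obtain ⟨σ, hσ⟩ := EllP.exists_sum_functional 𝕜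
  have h1 := hΛ (σ ∘L S) 1 (by
    refine tendsto_const_nhds.congr fun n => ?_
    change 1 = σ (S (T (e n)))
    rw [hST]
    refine HasSum.unique ?_ (hσ (e n))
    convert hasSum_single n fun l hl => ?_ using 1
    · exact (lp.single_apply_self (E := fun _ : ℕ => 𝕜) _ n 1).symm
    · exact lp.single_apply_ne (E := fun _ : ℕ => 𝕜) _ n 1 hl)
  rw [hx'] at h1
  have : (σ ∘L S) x = 0 := by
    change σ (S x) = 0
    rw [hSx, map_zero]
  exact zero_ne_one (this.symm.trans h1)

namespace Garling

open SupSpace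

variable {𝕜 : Type*} [RCLike 𝕜] {w : Weight} {p : ℝ≥0} [hp : Fact (1 ≤ p)]

/-- The unit vector basis is shrinking for `1 < p`. -/
theorem tendsto_norm_comp_tail (h1 : 1 < p) (h : Garling 𝕜 w p →L[𝕜] 𝕜) :
    Tendsto (fun N => ‖h ∘L restrict 𝕜 increasingMaps w p (Set.Ici N)‖) atTop (𝓝 0) := by
  have h0 := coe_pos p
  rw [Metric.tendsto_atTop]
  by_contra! hcon
  obtain ⟨δ, hδ, hcon⟩ := hcon
  -- If the functional does not vanish along the tails, disjoint finitely supported vectors in the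
  -- unit ball have `h`-values at least `δ / 2` after rotation. The sum of `m` of them has norm at
  -- most `m ^ (1/p)` by the upper `p`-estimate, too little for `h` to reach `m * δ / 2` when `1 <
  -- p`.
  have step : ∀ m : ℕ, ∃ (z : Garling 𝕜 w p) (M : ℕ), ‖z‖ ^ (p : ℝ) ≤ m ∧
      (∀ i, M ≤ i → toSeq z i = 0) ∧ (m : ℝ) * (δ / 2) ≤ RCLike.re (h z) := by
    intro m
    induction m with
    | zero => exact ⟨0, 0, by simp [Real.zero_rpow h0.ne'], by simp, by simp⟩
    | succ m ih =>
      obtain ⟨z, M, hz1, hz2, hz3⟩ := ih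
      obtain ⟨n, hn, hnδ⟩ := hcon M
      rw [Real.dist_eq, sub_zero, abs_of_nonneg (norm_nonneg _)] at hnδ
      obtain ⟨x, hx1, hx2⟩ := ContinuousLinearMap.exists_lt_apply_of_lt_opNorm _
        (show δ / 2 < ‖h ∘L restrict 𝕜 increasingMaps w p (Set.Ici n)‖ by linarith)
      set y := restrict 𝕜 increasingMaps w p (Set.Ici n) x
      have hlim : Tendsto (fun K => ‖h (restrict 𝕜 increasingMaps w p (Set.Iio K) y)‖) atTop
          (𝓝 ‖h y‖) := ((h.continuous.tendsto _).comp (tendsto_restrict_Iio y)).norm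
      obtain ⟨K, hKM, hK⟩ := ((eventually_ge_atTop M).and
        (hlim.eventually (lt_mem_nhds hx2))).exists
      set u := restrict 𝕜 increasingMaps w p (Set.Iio K) y
      have hu1 : ‖u‖ ≤ 1 := (norm_restrict_le _ _).trans ((norm_restrict_le _ _).trans hx1.le)
      obtain ⟨c, hc1, hc2⟩ := RCLike.exists_norm_eq_mul_self (h u)
      have hre : RCLike.re (h (c • u)) = ‖h u‖ := by
        rw [map_smul, smul_eq_mul, ← hc2, RCLike.ofReal_re]
      refine ⟨z + c • u, K, ?_, ?_, ?_⟩
      · refine (norm_rpow_add_le_of_disjoint fun i => ?_).trans ?_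
        · by_cases hi : i < M
          · right
            simp [u, y, (hi.trans_le hn).not_ge]
          · exact Or.inl (hz2 i (by omega))
        · push_cast
          refine add_le_add hz1 (Real.rpow_le_one (norm_nonneg _) ?_ h0.le)
          rw [norm_smul, hc1, one_mul]
          exact hu1
      · intro i hi
        simp [u, hz2 i (hKM.trans hi), hi]
      · rw [map_add, map_add, hre]
        push_cast
        linarith
  have hp1 : (0 : ℝ) < p - 1 := by
    have : (1 : ℝ) < p := by exact_mod_cast h1
    linarith
  have htend : Tendsto (fun m : ℕ => (m : ℝ) ^ ((p : ℝ) - 1)) atTop atTop :=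
    (tendsto_rpow_atTop hp1).comp tendsto_natCast_atTop_atTop
  obtain ⟨m, hm0, hm⟩ := ((eventually_gt_atTop 0).and (htend.eventually
    (eventually_gt_atTop (‖h‖ ^ (p : ℝ) / (δ / 2) ^ (p : ℝ))))).exists
  have hm0' : (0 : ℝ) < m := by exact_mod_cast hm0
  obtain ⟨z, -, hz1, -, hz2⟩ := step m
  have h3 : (m : ℝ) * (δ / 2) ≤ ‖h‖ * ‖z‖ :=
    hz2.trans ((RCLike.re_le_norm _).trans (h.le_opNorm z))
  have h4 := Real.rpow_le_rpow (by positivity) h3 h0.le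
  rw [Real.mul_rpow hm0'.le (by positivity), Real.mul_rpow (norm_nonneg _) (norm_nonneg _)] at h4
  have h5 := h4.trans (mul_le_mul_of_nonneg_left hz1 (by positivity))
  rw [div_lt_iff₀ (by positivity), Real.rpow_sub_one hm0'.ne', div_mul_eq_mul_div,
    lt_div_iff₀ hm0'] at hm
  linarith

/-- James's argument. The coordinates of `Λ` have partial sums bounded by `‖Λ‖`, so bounded
completeness produces `f`; since the basis is shrinking, `h` is the norm limit of its truncations,
and `f` represents `Λ`. -/
theorem isReflexive (h1 : 1 < p) : IsReflexive 𝕜 (Garling 𝕜 w p) := by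
  intro Λ
  set a : ℕ → 𝕜 := fun i => Λ (coord 𝕜 increasingMaps w p i) with ha
  have hsum : ∀ (h : StrongDual 𝕜 (Garling 𝕜 w p)) n,
      h (∑ i ∈ Finset.range n, a i • garlingUnit 𝕜 w p i)
        = Λ (h ∘L restrict 𝕜 increasingMaps w p (Set.Iio n)) := by
    intro h n
    have : h ∘L restrict 𝕜 increasingMaps w p (Set.Iio n)
        = ∑ i ∈ Finset.range n, h (garlingUnit 𝕜 w p i) • coord 𝕜 increasingMaps w p i := by
      refine ContinuousLinearMap.ext fun f => ?_
      rw [ContinuousLinearMap.comp_apply, ← Finset.coe_range, ← sum_smul_unitVector, map_sum,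
        sum_apply]
      refine Finset.sum_congr rfl fun i _ => ?_
      rw [map_smul, smul_apply, coord_apply, smul_eq_mul, smul_eq_mul, mul_comm]
    rw [this, map_sum, map_sum]
    refine Finset.sum_congr rfl fun i _ => ?_
    rw [map_smul, map_smul, smul_eq_mul, smul_eq_mul, mul_comm]
  obtain ⟨f, hf, -⟩ := exists_of_norm_sum_le (w := w) (p := p) a (C := ‖Λ‖) (fun n => by
    refine NormedSpace.norm_le_dual_bound 𝕜 _ (norm_nonneg Λ) fun h => ?_
    rw [hsum]
    refine (Λ.le_opNorm _).trans (mul_le_mul_of_nonneg_left ?_ (norm_nonneg _))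
    refine ContinuousLinearMap.opNorm_le_bound _ (norm_nonneg _) fun x => ?_
    exact (h.le_opNorm _).trans (mul_le_mul_of_nonneg_left (norm_restrict_le _ _) (norm_nonneg _)))
  refine ⟨f, ContinuousLinearMap.ext fun h => ?_⟩
  rw [NormedSpace.dual_def]
  have e1 : Tendsto (fun n => h ∘L restrict 𝕜 increasingMaps w p (Set.Iio n)) atTop (𝓝 h) := by
    rw [tendsto_iff_norm_sub_tendsto_zero]
    refine (tendsto_norm_comp_tail h1 h).congr fun n => ?_
    rw [norm_sub_rev]
    congr 1
    refine ContinuousLinearMap.ext fun x => ?_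
    have := congrArg h (restrict_add_compl (Set.Iio n) x)
    rw [map_add, Set.compl_Iio] at this
    rw [ContinuousLinearMap.comp_apply, sub_apply,
      ContinuousLinearMap.comp_apply, ← this, add_sub_cancel_left]
  have e2 := (Λ.continuous.tendsto h).comp e1
  have e3 := (h.continuous.tendsto f).comp (tendsto_sum_unit f)
  refine tendsto_nhds_unique e3 (e2.congr fun n => ?_)
  simp only [Function.comp_apply]
  rw [← hsum, hf]

theorem not_isReflexive (w : Weight) [Fact ((1 : ℝ≥0) ≤ 1)] :
    ¬ IsReflexive 𝕜 (Garling 𝕜 w 1) := by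
  obtain ⟨T, S, h⟩ := exists_factorization_lorentzInclusion 𝕜 w 1
  exact not_isReflexive_of_ellOne (lorentzInclusion 𝕜 w 1 ∘L T) S h

end Garling

/-! ### Growth of sums of unit vectors, and non-embedding into `ℓ_p` -/

namespace Garling

open SupSpace

variable {𝕜 : Type*} [RCLike 𝕜] {w : Weight} {p : ℝ≥0} [hp : Fact (1 ≤ p)]

theorem norm_le_of_forall_sum_le (f : Garling 𝕜 w p) {C : ℝ} (hC : 0 ≤ C)
    (h : ∀ φ : ℕ → ℕ, StrictMono φ → ∀ N,
      ∑ n ∈ Finset.range N, ‖toSeq f (φ n)‖ ^ (p : ℝ) * w n ≤ C ^ (p : ℝ)) : ‖f‖ ≤ C := by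
  by_contra! hlt
  obtain ⟨φ, hφ, N, hN⟩ := exists_lt_sum f (Real.rpow_lt_rpow hC hlt (coe_pos p))
  exact (h φ hφ N).not_gt hN

/-- A finite increasing partial map extends to an infinite set of indices: far out, `n + K` exceeds
all its values. -/
theorem sum_le_norm_rpow_of_finset (f : Garling 𝕜 w p) {s : Finset ℕ} {ψ : ℕ → ℕ}
    (hψ : StrictMonoOn ψ s) : ∑ n ∈ s, ‖toSeq f (ψ n)‖ ^ (p : ℝ) * w n ≤ ‖f‖ ^ (p : ℝ) := by
  classical
  obtain ⟨M, hM⟩ := s.exists_nat_subset_range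
  set K := ∑ n ∈ s, (ψ n + 1)
  have hK : ∀ n ∈ s, ψ n < K := fun n hn =>
    (Nat.lt_succ_self _).trans_le
      (Finset.single_le_sum (f := fun n => ψ n + 1) (fun _ _ => Nat.zero_le _) hn)
  set ψ' : ℕ → ℕ := fun n => if n ∈ s then ψ n else n + K
  have hmono : StrictMonoOn ψ' (↑s ∪ Set.Ici M) := by
    have hlt : ∀ n ∈ s, n < M := fun n hn => Finset.mem_range.1 (hM hn)
    intro a ha b hb hab
    by_cases h1 : a ∈ s <;> by_cases h2 : b ∈ s
    · simp only [ψ', h1, h2, if_true]; exact hψ h1 h2 hab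
    · simp only [ψ', h1, h2, if_true, if_false]; have := hK a h1; omega
    · have : M ≤ a := ha.resolve_left h1
      have := hlt b h2
      omega
    · simp only [ψ', h1, h2, if_false]; omega
  refine le_trans (le_of_eq ?_) (sum_le_norm_rpow f ((Set.Ici_infinite M).mono
    Set.subset_union_right) hmono (s := s) Set.subset_union_left)
  exact Finset.sum_congr rfl fun n hn => by simp only [ψ', hn, if_true]

/-- Spreading out the coefficients does not increase the norm. -/
theorem norm_sum_spread_le {τ : ℕ → ℕ} (hτ : StrictMono τ) (a : ℕ → 𝕜) (s : Finset ℕ) :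
    ‖∑ l ∈ s, a l • garlingUnit 𝕜 w p (τ l)‖ ≤ ‖∑ l ∈ s, a l • garlingUnit 𝕜 w p l‖ := by
  classical
  have h0 := coe_pos p
  set f := ∑ l ∈ s, a l • garlingUnit 𝕜 w p (τ l)
  set g := ∑ l ∈ s, a l • garlingUnit 𝕜 w p l
  have hg : ∀ l, toSeq g l = if l ∈ s then a l else 0 := toSeq_sum_smul_unitVector a s
  have hf : ∀ l, toSeq f (τ l) = toSeq g l := fun l => by
    rw [hg]
    simp [f, map_sum, Finset.sum_apply, Pi.single_apply, hτ.injective.eq_iff]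
  have hf0 : ∀ i, i ∉ Set.range τ → toSeq f i = 0 := fun i hi => by
    have : ∀ l, ¬ i = τ l := fun l h => hi ⟨l, h.symm⟩
    simp [f, map_sum, Finset.sum_apply, this]
  refine norm_le_of_forall_sum_le f (norm_nonneg _) fun φ hφ N => ?_
  set J : Finset ℕ := (Finset.range N).filter fun n => φ n ∈ Set.range τ
  -- Terms with `φ n` outside the range of `τ` vanish; on the others, `τ⁻¹ ∘ φ` is an increasing map
  -- competing for the norm of `g`.
  set ψ : ℕ → ℕ := fun n => Function.invFun τ (φ n)
  have hψ : ∀ n ∈ J, τ (ψ n) = φ n := fun n hn =>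
    Function.invFun_eq (Finset.mem_filter.1 hn).2
  have hmono : StrictMonoOn ψ J := fun a ha b hb hab => by
    rw [← hτ.lt_iff_lt, hψ a ha, hψ b hb]
    exact hφ hab
  refine le_trans (le_of_eq ?_) (sum_le_norm_rpow_of_finset g hmono)
  rw [← Finset.sum_subset (Finset.filter_subset (fun n => φ n ∈ Set.range τ) (Finset.range N))]
  · exact Finset.sum_congr rfl fun n hn => by rw [← hψ n hn, hf]
  · intro n hn hn'
    rw [hf0 _ fun h => hn' (Finset.mem_filter.2 ⟨hn, h⟩), norm_zero, Real.zero_rpow h0.ne', zero_mul]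

/-- An injective `φ` hits `s` at most `s.card` times, and the heaviest weights come first. -/
theorem norm_sum_smul_unit_rpow_le (s : Finset ℕ) (c : ℕ → 𝕜) (hc : ∀ n, ‖c n‖ ≤ 1) :
    ‖∑ n ∈ s, c n • garlingUnit 𝕜 w p n‖ ^ (p : ℝ) ≤ ∑ n ∈ Finset.range s.card, w n := by
  classical
  have h0 := coe_pos p
  set W := ∑ n ∈ Finset.range s.card, w n
  have hW : 0 ≤ W := Finset.sum_nonneg fun n _ => (w.pos n).le
  have hWp : (W ^ (p : ℝ)⁻¹) ^ (p : ℝ) = W := Real.rpow_inv_rpow hW h0.ne'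
  rw [← hWp, Real.rpow_le_rpow_iff (norm_nonneg _) (by positivity) h0]
  refine norm_le_of_forall_sum_le _ (by positivity) fun φ hφ N => ?_
  rw [hWp]
  have h1 : ∀ n ∈ Finset.range N,
      ‖toSeq (∑ n ∈ s, c n • garlingUnit 𝕜 w p n) (φ n)‖ ^ (p : ℝ) * w n
        ≤ if φ n ∈ s then w n else 0 := fun n _ => by
    have h2 := toSeq_sum_smul_unitVector (Φ := increasingMaps) (w := w) (p := p) c s (φ n)
    rw [h2]
    split_ifs with h
    · exact mul_le_of_le_one_left (w.pos n).le (Real.rpow_le_one (norm_nonneg _) (hc _) h0.le)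
    · rw [norm_zero, Real.zero_rpow h0.ne', zero_mul]
  refine (Finset.sum_le_sum h1).trans ?_
  rw [← Finset.sum_filter]
  refine (w.sum_le_sum_range _).trans (Finset.sum_le_sum_of_subset_of_nonneg
      (Finset.range_mono ?_) fun i _ _ => (w.pos i).le)
  exact Finset.card_le_card_of_injOn φ (fun n hn => (Finset.mem_filter.1 hn).2) hφ.injective.injOn

/-- A positive multiple of `m` cannot be dominated by the sum of the first `m` weights. -/
theorem exists_sum_weight_lt (w : Weight) {c : ℝ} (hc : 0 < c) (B : ℝ) :
    ∃ m : ℕ, 0 < m ∧ B * ∑ n ∈ Finset.range m, w n < m * c := by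
  have h := w.sum_range_div_tendsto.const_mul B
  rw [mul_zero] at h
  obtain ⟨m, hm0, hm⟩ := ((eventually_gt_atTop 0).and (h.eventually (gt_mem_nhds hc))).exists
  have hm0' : (0 : ℝ) < m := by exact_mod_cast hm0
  rw [← mul_div_assoc, div_lt_iff₀ hm0'] at hm
  exact ⟨m, hm0, by linarith⟩

/-- The unit vector basis is weakly null. -/
theorem tendsto_zero_of_dominated (z : ℕ → 𝕜) {C : ℝ} (hC : 0 ≤ C)
    (hz : ∀ (c : ℕ → 𝕜) (s : Finset ℕ), ‖∑ n ∈ s, c n • z n‖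
      ≤ C * ‖∑ n ∈ s, c n • garlingUnit 𝕜 w p n‖) : Tendsto z atTop (𝓝 0) := by
  have h0 := coe_pos p
  have h1p : (1 : ℝ) ≤ p := by exact_mod_cast hp.out
  by_contra hcon
  rw [Metric.tendsto_atTop] at hcon
  push Not at hcon
  obtain ⟨δ, hδ, hcon⟩ := hcon
  simp only [dist_zero_right] at hcon
  have hinf : {n | δ ≤ ‖z n‖}.Infinite :=
    Set.infinite_of_not_bddAbove fun ⟨N, hN⟩ => by
      obtain ⟨n, hn, hn'⟩ := hcon (N + 1)
      exact absurd (hN hn') (by omega)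
  obtain ⟨m, hm0, hm⟩ := exists_sum_weight_lt w (c := δ ^ (p : ℝ)) (by positivity) (C ^ (p : ℝ))
  obtain ⟨s, hs, hcard⟩ := hinf.exists_subset_card_eq m
  choose c hc1 hc2 using fun n => RCLike.exists_norm_eq_mul_self (z n)
  -- Unimodular `c n` align the scalars, so `m` of them add up to at least `m * δ`. Domination
  -- allows only `C ^ p * (w 0 + ... + w (m-1))` for the `p`-th power, which is `o(m)`.
  have h2 : (m : ℝ) * δ ≤ ‖∑ n ∈ s, c n • z n‖ := by
    have : ∑ n ∈ s, c n • z n = ((∑ n ∈ s, ‖z n‖ : ℝ) : 𝕜) := by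
      rw [RCLike.ofReal_sum]
      exact Finset.sum_congr rfl fun n _ => by rw [hc2, smul_eq_mul]
    rw [this, RCLike.norm_ofReal, abs_of_nonneg (Finset.sum_nonneg fun _ _ => norm_nonneg _),
      ← hcard, ← nsmul_eq_mul]
    exact Finset.card_nsmul_le_sum _ _ _ fun n hn => hs hn
  have h3 := Real.rpow_le_rpow (by positivity) (h2.trans (hz c s)) h0.le
  rw [Real.mul_rpow (by positivity) hδ.le, Real.mul_rpow hC (norm_nonneg _)] at h3
  have h4 := norm_sum_smul_unit_rpow_le (w := w) (p := p) s c fun n => (hc1 n).le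
  rw [hcard] at h4
  have h5 : (m : ℝ) ≤ (m : ℝ) ^ (p : ℝ) :=
    Real.self_le_rpow_of_one_le (by exact_mod_cast hm0) h1p
  have h6 : (m : ℝ) * δ ^ (p : ℝ) ≤ (m : ℝ) ^ (p : ℝ) * δ ^ (p : ℝ) :=
    mul_le_mul_of_nonneg_right h5 (by positivity)
  have h7 := mul_le_mul_of_nonneg_left h4 (show 0 ≤ C ^ (p : ℝ) by positivity)
  linarith

/-- Seminormalized coordinatewise null sequences in `ℓ_p` contain sums of `m` vectors with norm of
order at least `m ^ (1/p)`. -/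
theorem exists_le_norm_sum_rpow (x : ℕ → EllP 𝕜 p)
    (hx0 : ∀ i, Tendsto (fun n => x n i) atTop (𝓝 0)) {c : ℝ} (hc : 0 < c)
    (hxc : ∀ n, c ≤ ‖x n‖) (m : ℕ) :
    ∃ s : Finset ℕ, s.card = m ∧ m * (c / 4) ^ (p : ℝ) ≤ ‖∑ n ∈ s, x n‖ ^ (p : ℝ) := by
  classical
  have h0 := coe_pos p
  rcases Nat.eq_zero_or_pos m with rfl | hm
  · exact ⟨∅, rfl, by simp [Real.zero_rpow h0.ne']⟩
  set e : ℕ → 𝕜 → EllP 𝕜 p := fun i a => lp.single (p : ℝ≥0∞) i a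
  have he : ∀ (f : ℕ → 𝕜) (s : Finset ℕ),
      ‖∑ i ∈ s, e i (f i)‖ ^ (p : ℝ) = ∑ i ∈ s, ‖f i‖ ^ (p : ℝ) := fun f s => by
    simpa using lp.norm_sum_single (E := fun _ : ℕ => 𝕜) (EllP.toReal_pos p) f s
  have he1 : ∀ i a, ‖e i a‖ = ‖a‖ := fun i a =>
    lp.norm_single (E := fun _ : ℕ => 𝕜) (zero_lt_one.trans_le (fact_one_le_coe p).out) i a
  -- Gliding hump: the sum of `k` vectors is within `k * η` of a sum of disjoint blocks, each of
  -- norm at least `c / 2`, whose coefficients are recorded in `ζ`.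
  have step : ∀ η : ℝ, 0 < η → η ≤ c / 2 → ∀ k : ℕ, ∃ (s : Finset ℕ) (N : ℕ) (ζ : ℕ → 𝕜),
      s.card = k ∧ k * (c / 2) ^ (p : ℝ) ≤ ∑ i ∈ Finset.range N, ‖ζ i‖ ^ (p : ℝ) ∧
      ‖∑ n ∈ s, x n - ∑ i ∈ Finset.range N, e i (ζ i)‖ ≤ k * η := by
    intro η hη hηc k
    induction k with
    | zero => exact ⟨∅, 0, 0, rfl, by simp, by simp⟩
    | succ k ih =>
      obtain ⟨s, N, ζ, hs, h1, h2⟩ := ih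
      have hhead : Tendsto (fun n => ∑ i ∈ Finset.range N, ‖x n i‖) atTop (𝓝 0) := by
        simpa using tendsto_finsetSum (Finset.range N) fun i _ => (hx0 i).norm
      obtain ⟨n, hns, hn⟩ := ((eventually_gt_atTop (s.sup id)).and
        (hhead.eventually (gt_mem_nhds (half_pos hη)))).exists
      have hns' : n ∉ s := fun h => absurd (Finset.le_sup (f := id) h) (not_le.2 hns)
      have htail := (lp.hasSum_single (E := fun _ : ℕ => 𝕜) (p := (p : ℝ≥0∞)) ENNReal.coe_ne_top
        (x n)).tendsto_sum_nat
      obtain ⟨N₀, hN₀⟩ := Metric.tendsto_atTop.1 htail (η / 2) (half_pos hη)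
      set N' := max N N₀
      have hNN : N ≤ N' := le_max_left _ _
      have htl : ‖x n - ∑ i ∈ Finset.range N', e i (x n i)‖ ≤ η / 2 := by
        rw [norm_sub_rev, ← dist_eq_norm]
        exact (hN₀ N' (le_max_right _ _)).le
      have hhd : ‖∑ i ∈ Finset.range N, e i (x n i)‖ ≤ η / 2 := by
        refine (norm_sum_le _ _).trans ((le_of_eq ?_).trans hn.le)
        exact Finset.sum_congr rfl fun i _ => he1 i _
      set u := ∑ i ∈ Finset.Ico N N', e i (x n i)
      have hu : ‖x n - u‖ ≤ η := by
        have : x n - u = (x n - ∑ i ∈ Finset.range N', e i (x n i))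
            + ∑ i ∈ Finset.range N, e i (x n i) := by
          rw [← Finset.sum_range_add_sum_Ico _ hNN]
          abel
        rw [this]
        linarith [norm_add_le (x n - ∑ i ∈ Finset.range N', e i (x n i))
          (∑ i ∈ Finset.range N, e i (x n i))]
      have huc : c / 2 ≤ ‖u‖ := by
        have := norm_sub_norm_le (x n) u
        linarith [hxc n]
      refine ⟨insert n s, N', fun i => if i < N then ζ i else x n i, ?_, ?_, ?_⟩
      · rw [Finset.card_insert_of_notMem hns', hs]
      · rw [← Finset.sum_range_add_sum_Ico _ hNN]
        have e1 : ∑ i ∈ Finset.range N, ‖if i < N then ζ i else x n i‖ ^ (p : ℝ)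
            = ∑ i ∈ Finset.range N, ‖ζ i‖ ^ (p : ℝ) :=
          Finset.sum_congr rfl fun i hi => by rw [if_pos (Finset.mem_range.1 hi)]
        have e2 : ∑ i ∈ Finset.Ico N N', ‖if i < N then ζ i else x n i‖ ^ (p : ℝ)
            = ‖u‖ ^ (p : ℝ) := by
          rw [he]
          exact Finset.sum_congr rfl fun i hi => by rw [if_neg (Finset.mem_Ico.1 hi).1.not_gt]
        rw [e1, e2]
        push_cast
        have := Real.rpow_le_rpow (by positivity) huc h0.le
        linarith
      · have e1 : ∑ i ∈ Finset.range N', e i (if i < N then ζ i else x n i)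
            = ∑ i ∈ Finset.range N, e i (ζ i) + u := by
          rw [← Finset.sum_range_add_sum_Ico _ hNN]
          congr 1
          · exact Finset.sum_congr rfl fun i hi => by rw [if_pos (Finset.mem_range.1 hi)]
          · exact Finset.sum_congr rfl fun i hi => by rw [if_neg (Finset.mem_Ico.1 hi).1.not_gt]
        rw [e1, Finset.sum_insert hns', add_comm (x n), add_sub_add_comm]
        push_cast
        linarith [norm_add_le (∑ n ∈ s, x n - ∑ i ∈ Finset.range N, e i (ζ i)) (x n - u)]
  have hm0 : (0 : ℝ) < m := by exact_mod_cast hm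
  set R : ℝ := (m : ℝ) ^ (p : ℝ)⁻¹ * (c / 2) with hR
  have hR0 : 0 < R := by positivity
  have hRp : R ^ (p : ℝ) = m * (c / 2) ^ (p : ℝ) := by
    rw [hR, Real.mul_rpow (by positivity) (by positivity), Real.rpow_inv_rpow hm0.le h0.ne']
  -- The blocks have total norm at least `R`, and the accumulated error is kept below `R / 2`; this
  -- halving turns `c / 2` into `c / 4`.
  obtain ⟨s, N, ζ, hs, h1, h2⟩ := step (min (c / 2) (R / (2 * m))) (by positivity)
    (min_le_left _ _) m
  refine ⟨s, hs, ?_⟩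
  rw [← hRp, ← he, Real.rpow_le_rpow_iff hR0.le (norm_nonneg _) h0] at h1
  have h3 : m * min (c / 2) (R / (2 * m)) ≤ R / 2 := by
    refine (mul_le_mul_of_nonneg_left (min_le_right _ _) hm0.le).trans (le_of_eq ?_)
    field_simp
  have h4 : R / 2 ≤ ‖∑ n ∈ s, x n‖ := by
    have := norm_sub_norm_le (∑ i ∈ Finset.range N, e i (ζ i)) (∑ n ∈ s, x n)
    rw [norm_sub_rev] at this
    linarith
  have h5 := Real.rpow_le_rpow (by positivity) h4 h0.le
  have h6 : R / 2 = (m : ℝ) ^ (p : ℝ)⁻¹ * (c / 4) := by rw [hR]; ring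
  rw [h6, Real.mul_rpow (by positivity) (by positivity), Real.rpow_inv_rpow hm0.le h0.ne'] at h5
  exact h5

theorem norm_unit (n : ℕ) : ‖garlingUnit 𝕜 w p n‖ = 1 := by
  refine le_antisymm (norm_unitVector_le n) ?_
  have := norm_apply_le (garlingUnit 𝕜 w p n) n
  simpa using this

/-- No subspace of `ℓ_p` is isomorphic to `g(w,p)`. -/
theorem not_isomorphic_subspace_ellP (Y : Submodule 𝕜 (EllP 𝕜 p)) (e : Y ≃L[𝕜] Garling 𝕜 w p) :
    False := by
  have h0 := coe_pos p
  set J : Garling 𝕜 w p →L[𝕜] EllP 𝕜 p := Y.subtypeL ∘L (e.symm : Garling 𝕜 w p →L[𝕜] Y)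
  set x : ℕ → EllP 𝕜 p := fun n => J (garlingUnit 𝕜 w p n)
  set B : ℝ := ‖(e : Y →L[𝕜] Garling 𝕜 w p)‖
  have hB : ∀ f, ‖f‖ ≤ B * ‖J f‖ := fun f => by
    have := (e : Y →L[𝕜] Garling 𝕜 w p).le_opNorm (e.symm f)
    rw [ContinuousLinearEquiv.coe_coe, e.apply_symm_apply] at this
    exact this
  have hB0 : 0 < B := by
    have h1 := hB (garlingUnit 𝕜 w p 0)
    rw [norm_unit] at h1
    by_contra h
    nlinarith [norm_nonneg (J (garlingUnit 𝕜 w p 0)), norm_nonneg (e : Y →L[𝕜] Garling 𝕜 w p)]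
  have hx0 : ∀ i, Tendsto (fun n => x n i) atTop (𝓝 0) := fun i => by
    refine tendsto_zero_of_dominated (w := w) (p := p) _ (norm_nonneg J) fun c s => ?_
    have : ∑ n ∈ s, c n • x n i = (EllP.coord 𝕜 p i) (J (∑ n ∈ s, c n • garlingUnit 𝕜 w p n)) := by
      rw [map_sum, map_sum]
      exact Finset.sum_congr rfl fun n _ => by rw [map_smul, map_smul]; rfl
    rw [this]
    refine le_trans ?_ (J.le_opNorm _)
    refine ((EllP.coord 𝕜 p i).le_opNorm _).trans ?_
    exact mul_le_of_le_one_left (norm_nonneg _) (EllP.norm_coord_le i)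
  have hxc : ∀ n, B⁻¹ ≤ ‖x n‖ := fun n => by
    have := hB (garlingUnit 𝕜 w p n)
    rw [norm_unit] at this
    rwa [inv_le_iff_one_le_mul₀' hB0]
  -- For this `m`, the lower bound of order `m` in `ℓ_p` contradicts the `o(m)` bound for the unit
  -- vectors, transported by `J`.
  obtain ⟨m, -, hm⟩ := exists_sum_weight_lt w (c := (B⁻¹ / 4) ^ (p : ℝ)) (by positivity)
    (‖J‖ ^ (p : ℝ))
  obtain ⟨s, hs, hle⟩ := exists_le_norm_sum_rpow x hx0 (inv_pos.2 hB0) hxc m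
  have h1 := norm_sum_smul_unit_rpow_le (𝕜 := 𝕜) (w := w) (p := p) s (fun _ => 1) (by simp)
  have h2 : ‖∑ n ∈ s, x n‖ ≤ ‖J‖ * ‖∑ n ∈ s, (1 : 𝕜) • garlingUnit 𝕜 w p n‖ := by
    simp only [x, one_smul, ← map_sum]
    exact J.le_opNorm _
  have h3 := Real.rpow_le_rpow (norm_nonneg _) h2 h0.le
  rw [Real.mul_rpow (norm_nonneg _) (norm_nonneg _)] at h3
  have h4 := mul_le_mul_of_nonneg_left h1 (show 0 ≤ ‖J‖ ^ (p : ℝ) by positivity)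
  rw [hs] at h4
  linarith

end Garling

/-! ### Complemented subsequences of sequences equivalent to the basis -/

theorem Dominates.exists_norm_sum_le {𝕜 X Y : Type*} [RCLike 𝕜] [NormedAddCommGroup X]
    [NormedSpace 𝕜 X] [NormedAddCommGroup Y] [NormedSpace 𝕜 Y] {x : ℕ → X} {y : ℕ → Y}
    (h : Dominates 𝕜 y x) : ∃ C : ℝ, 0 < C ∧ ∀ (a : ℕ → 𝕜) (s : Finset ℕ),
      ‖∑ n ∈ s, a n • x n‖ ≤ C * ‖∑ n ∈ s, a n • y n‖ := by
  classical
  obtain ⟨C, hC, h⟩ := h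
  refine ⟨C, hC, fun a s => ?_⟩
  have := h (Finsupp.onFinset s (fun n => if n ∈ s then a n else 0) fun n hn => by
    by_contra hns; simp [hns] at hn)
  rw [Finsupp.onFinset_sum (g := fun n c => c • x n) _ fun n => zero_smul 𝕜 (x n),
    Finsupp.onFinset_sum (g := fun n c => c • y n) _ fun n => zero_smul 𝕜 (y n),
    Finset.sum_congr (g := fun n => a n • x n) rfl fun n hn => by rw [if_pos hn],
    Finset.sum_congr (g := fun n => a n • y n) rfl fun n hn => by rw [if_pos hn]] at this
  exact this

namespace Garling

open SupSpace

variable {𝕜 : Type*} [RCLike 𝕜] {w : Weight} {p : ℝ≥0} [hp : Fact (1 ≤ p)]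

/-- A sequence dominated by the unit vectors is the image of the unit vectors under an operator. -/
theorem exists_clm_of_dominated {X : Type*} [NormedAddCommGroup X] [NormedSpace 𝕜 X]
    [CompleteSpace X] (x : ℕ → X) {C : ℝ} (hC : 0 < C)
    (h : ∀ (a : ℕ → 𝕜) (s : Finset ℕ), ‖∑ n ∈ s, a n • x n‖
      ≤ C * ‖∑ n ∈ s, a n • garlingUnit 𝕜 w p n‖) :
    ∃ T : Garling 𝕜 w p →L[𝕜] X, ∀ n, T (garlingUnit 𝕜 w p n) = x n := by
  have hlim : ∀ f : Garling 𝕜 w p, ∃ t,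
      Tendsto (fun N => ∑ n ∈ Finset.range N, toSeq f n • x n) atTop (𝓝 t) := by
    intro f
    refine cauchySeq_tendsto_of_complete (Metric.cauchySeq_iff'.2 fun ε hε => ?_)
    obtain ⟨N, hN⟩ := Metric.cauchySeq_iff'.1 (tendsto_sum_unit f).cauchySeq (ε / C) (by positivity)
    refine ⟨N, fun n hn => ?_⟩
    have h1 := hN n hn
    rw [dist_eq_norm, ← Finset.sum_Ico_eq_sub _ hn] at h1 ⊢
    refine (h _ _).trans_lt ?_
    rwa [lt_div_iff₀' hC] at h1
  choose t ht using hlim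
  let P : ℕ → Garling 𝕜 w p →L[𝕜] X := fun N =>
    ∑ n ∈ Finset.range N, (coord 𝕜 increasingMaps w p n).smulRight (x n)
  have hP : Tendsto (fun N f => P N f) atTop (𝓝 t) := by
    rw [tendsto_pi_nhds]
    intro f
    refine (ht f).congr fun N => ?_
    simp [P, sum_apply]
  -- Boundedness of the pointwise limit is the Banach–Steinhaus theorem, available since the Garling
  -- space is complete.
  refine ⟨continuousLinearMapOfTendsto P hP, fun n => ?_⟩
  change t _ = _
  refine tendsto_nhds_unique (ht _) (tendsto_const_nhds.congr' ?_)
  filter_upwards [eventually_gt_atTop n] with N hN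
  rw [Finset.sum_eq_single n]
  · simp
  · intro l _ hl
    simp [hl]
  · intro h
    exact absurd (Finset.mem_range.2 hN) h

/-- Every coordinate of `f` is at most `‖f‖`, so an operator is controlled by the sum of the norms
of its values on the basis. -/
theorem opNorm_le_of_sum_le {X : Type*} [NormedAddCommGroup X] [NormedSpace 𝕜 X]
    (D : Garling 𝕜 w p →L[𝕜] X) {B : ℝ}
    (h : ∀ N, ∑ l ∈ Finset.range N, ‖D (garlingUnit 𝕜 w p l)‖ ≤ B) : ‖D‖ ≤ B := by
  have hB : 0 ≤ B := by simpa using h 0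
  refine ContinuousLinearMap.opNorm_le_bound _ hB fun f => ?_
  have h1 := ((D.continuous.tendsto f).comp (tendsto_sum_unit f)).norm
  refine le_of_tendsto h1 (Eventually.of_forall fun N => ?_)
  simp only [Function.comp_apply, map_sum, map_smul]
  refine (norm_sum_le _ _).trans ?_
  refine le_trans (Finset.sum_le_sum (g := fun l => ‖D (garlingUnit 𝕜 w p l)‖ * ‖f‖) fun l _ => ?_) ?_
  · rw [norm_smul, mul_comm]
    exact mul_le_mul_of_nonneg_left (norm_apply_le f l) (norm_nonneg _)
  · rw [← Finset.sum_mul]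
    exact mul_le_mul_of_nonneg_right (h N) (norm_nonneg _)

theorem norm_le_of_sum_apply_le (f : Garling 𝕜 w p) {B : ℝ}
    (h : ∀ N, ∑ l ∈ Finset.range N, ‖toSeq f l‖ ≤ B) : ‖f‖ ≤ B := by
  refine le_of_tendsto (tendsto_sum_unit f).norm (Eventually.of_forall fun N => ?_)
  refine (norm_sum_le _ _).trans (le_trans (Finset.sum_le_sum fun l _ => ?_) (h N))
  rw [norm_smul, norm_unit, mul_one]

/-- Passing to a subsequence of coordinates and multiplying by a bounded sequence. -/
theorem exists_clm_subsequence {j : ℕ → ℕ} (hj : StrictMono j) (β : ℕ → 𝕜) {B : ℝ} (hB : 0 ≤ B)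
    (hβ : ∀ k, ‖β k‖ ≤ B) :
    ∃ S : Garling 𝕜 w p →L[𝕜] Garling 𝕜 w p, ∀ f k, toSeq (S f) k = β k * toSeq f (j k) := by
  have hex : ∀ f : Garling 𝕜 w p, ∃ g : Garling 𝕜 w p,
      toSeq g = (fun k => β k * toSeq f (j k)) ∧ ‖g‖ ≤ B * ‖f‖ := by
    intro f
    obtain ⟨g, hg, hgn⟩ := exists_of_supPow_le (Φ := increasingMaps) (w := w) (p := p)
      (a := fun k => toSeq f (j k)) (norm_nonneg f) (by
        rw [← supPow_toSeq]
        -- Composing with the increasing `j` keeps `φ` admissible, so selecting coordinates is a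
        -- contraction.
        exact iSup₂_le fun φ hφ => tsum_le_supPow (Φ := increasingMaps) (φ := j ∘ φ) (toSeq f)
          (hj.comp hφ))
    obtain ⟨g', hg', hgn'⟩ := exists_of_forall_le g hB (a := fun k => β k * toSeq f (j k))
      (fun k => by
        rw [hg, norm_mul]
        exact mul_le_mul_of_nonneg_right (hβ k) (norm_nonneg _))
    exact ⟨g', hg', hgn'.trans (mul_le_mul_of_nonneg_left hgn hB)⟩
  choose S hS hSn using hex
  let L : Garling 𝕜 w p →ₗ[𝕜] Garling 𝕜 w p :=
    { toFun := S
      map_add' := fun f g => ext fun k => by simp [hS, mul_add]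
      map_smul' := fun c f => ext fun k => by simp [hS, mul_left_comm] }
  exact ⟨L.mkContinuous B hSn, fun f k => congrFun (hS f) k⟩

/-- A seminormalized sequence with a subsequence whose coordinates tend uniformly to `0` has a
subsequence with complemented span. -/
theorem exists_complemented_of_small {y : ℕ → Garling 𝕜 w p} {c : ℝ} (hc : 0 < c)
    (hy : ∀ n, c ≤ ‖y n‖) (hsmall : ∀ δ : ℝ, 0 < δ → ∃ᶠ n in atTop, ∀ i, ‖toSeq (y n) i‖ ≤ δ) :
    ∃ k : ℕ → ℕ, StrictMono k ∧ (closedSpan 𝕜 (y ∘ k)).ClosedComplemented := by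
  obtain ⟨κ₀, hκ₀, hκ₀'⟩ := extraction_forall_of_frequently
    (P := fun n k => ∀ i, ‖toSeq (y k) i‖ ≤ 1 / ((n : ℝ) + 1))
    fun n => hsmall _ Nat.one_div_pos_of_nat
  have hy0 : ∀ n, 0 < ‖y n‖ := fun n => hc.trans_le (hy n)
  set x : ℕ → Garling 𝕜 w p := fun n => ((‖y (κ₀ n)‖⁻¹ : ℝ) : 𝕜) • y (κ₀ n)
  have hx1 : ∀ n, ‖x n‖ = 1 := fun n => by
    simp only [x]
    rw [norm_smul, RCLike.norm_ofReal, abs_of_nonneg (by positivity), inv_mul_cancel₀ (hy0 _).ne']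
  obtain ⟨κ, hκ, T, S, hT, hST, -⟩ := exists_ellP_factorization x hx1 (fun δ hδ => by
    filter_upwards [(tendsto_one_div_add_atTop_nhds_zero_nat (𝕜 := ℝ)).eventually
      (gt_mem_nhds (mul_pos hc hδ))] with n hn i
    simp only [x]
    rw [map_smul, Pi.smul_apply, norm_smul, RCLike.norm_ofReal, abs_of_nonneg (by positivity),
      inv_mul_le_iff₀ (hy0 _)]
    have := hκ₀' n i
    nlinarith [hy (κ₀ n)]) one_pos
  refine ⟨κ₀ ∘ κ, hκ₀.comp hκ, ?_⟩
  refine closedComplemented_of_leftInverse hST EllP.closedSpan_single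
    (c := fun i => ((‖y (κ₀ (κ i))‖⁻¹ : ℝ) : 𝕜)) (fun i => ?_) hT
  exact RCLike.ofReal_ne_zero.2 (inv_ne_zero (hy0 _).ne')

/-- A coordinatewise null sequence which is dominated by the unit vectors, and whose coordinates do
not tend uniformly to `0`, has a subsequence with complemented span. -/
theorem exists_complemented_of_large {y : ℕ → Garling 𝕜 w p} {C : ℝ} (hC : 0 < C)
    (hdom : ∀ (a : ℕ → 𝕜) (s : Finset ℕ), ‖∑ n ∈ s, a n • y n‖
      ≤ C * ‖∑ n ∈ s, a n • garlingUnit 𝕜 w p n‖)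
    (hy0 : ∀ i, Tendsto (fun n => toSeq (y n) i) atTop (𝓝 0)) {δ : ℝ} (hδ : 0 < δ)
    (hlarge : ∀ᶠ n in atTop, ∃ i, δ < ‖toSeq (y n) i‖) :
    ∃ k : ℕ → ℕ, StrictMono k ∧ (closedSpan 𝕜 (y ∘ k)).ClosedComplemented := by
  obtain ⟨n₀, hn₀⟩ := eventually_atTop.1 hlarge
  choose! j hj using hn₀
  -- The positions of the large coordinates escape to infinity, because each fixed coordinate tends
  -- to `0` along the sequence.
  have hj_top : Tendsto j atTop atTop := by
    refine tendsto_atTop.2 fun M => ?_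
    have : ∀ᶠ n in atTop, ∀ i ∈ Finset.range M, ‖toSeq (y n) i‖ < δ :=
      (Finset.eventually_all _).2 fun i _ => by
        simpa using (hy0 i).norm.eventually (gt_mem_nhds (by simpa using hδ))
    filter_upwards [this, eventually_ge_atTop n₀] with n h1 h2
    by_contra h
    exact (h1 (j n) (Finset.mem_range.2 (not_le.1 h))).not_gt (hj n h2)
  have step : ∀ (k s : ℕ), ∃ t, s < t ∧ n₀ ≤ t ∧ ∀ n ≤ s, j n < j t ∧
      ‖toSeq (y t) (j n)‖ ≤ δ / 8 * (1 / 4) ^ k ∧ ‖toSeq (y n) (j t)‖ ≤ δ / 8 * (1 / 4) ^ k := by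
    intro k s
    have hpos : 0 < δ / 8 * (1 / 4) ^ k := by positivity
    have h1 : ∀ᶠ t in atTop, ∀ n ∈ Finset.range (s + 1), j n < j t ∧
        ‖toSeq (y t) (j n)‖ ≤ δ / 8 * (1 / 4) ^ k ∧ ‖toSeq (y n) (j t)‖ ≤ δ / 8 * (1 / 4) ^ k := by
      refine (Finset.eventually_all _).2 fun n _ => ?_
      have e1 := hj_top.eventually (eventually_gt_atTop (j n))
      have e2 : ∀ᶠ t in atTop, ‖toSeq (y t) (j n)‖ < δ / 8 * (1 / 4) ^ k := by
        simpa using (hy0 (j n)).norm.eventually (gt_mem_nhds (by simpa using hpos))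
      have e3 : ∀ᶠ t in atTop, ‖toSeq (y n) (j t)‖ < δ / 8 * (1 / 4) ^ k := by
        simpa using ((tendsto_apply_zero (y n)).comp hj_top).norm.eventually
          (gt_mem_nhds (by simpa using hpos))
      filter_upwards [e1, e2, e3] with t h1 h2 h3
      exact ⟨h1, h2.le, h3.le⟩
    obtain ⟨t, ht, ht1, ht2⟩ := (h1.and ((eventually_gt_atTop s).and
      (eventually_ge_atTop n₀))).exists
    exact ⟨t, ht1, ht2, fun n hn => ht n (Finset.mem_range.2 (Nat.lt_succ_of_le hn))⟩
  obtain ⟨u, -, hu⟩ := exists_seq_step _ step 0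
  choose hu1 hu2 hu3 using hu
  have humono : StrictMono u := strictMono_nat_of_lt_succ hu1
  -- The starting value `u 0` is skipped, as it need not be at least `n₀`.
  set θ : ℕ → ℕ := fun k => u (k + 1)
  have hθ : StrictMono θ := strictMono_nat_of_lt_succ fun k => hu1 (k + 1)
  have hjθ : StrictMono fun k => j (θ k) :=
    strictMono_nat_of_lt_succ fun k => (hu3 (k + 1) _ le_rfl).1
  set d : ℕ → 𝕜 := fun k => toSeq (y (θ k)) (j (θ k))
  have hd : ∀ k, δ < ‖d k‖ := fun k => hj _ (hu2 k)
  -- The construction bounds the entry `(k, l)` by a power of `1/4` with exponent the larger index;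
  -- splitting it gives decay in both indices.
  have hpow : ∀ {k l : ℕ}, k < l → (1 / 4 : ℝ) ^ l ≤ (1 / 2) ^ k * (1 / 2) ^ l := fun {k l} hkl => by
    have : (1 / 4 : ℝ) ^ l = (1 / 2) ^ l * (1 / 2) ^ l := by rw [← mul_pow]; norm_num
    rw [this]
    exact mul_le_mul_of_nonneg_right
      (pow_le_pow_of_le_one (by norm_num) (by norm_num) hkl.le) (by positivity)
  have hoff : ∀ k l, k ≠ l →
      ‖toSeq (y (θ l)) (j (θ k))‖ ≤ δ / 8 * ((1 / 2) ^ k * (1 / 2) ^ l) := by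
    intro k l hkl
    rcases lt_or_gt_of_ne hkl with h | h
    · exact ((hu3 l (θ k) (humono.monotone h)).2.1).trans
        (mul_le_mul_of_nonneg_left (hpow h) (by positivity))
    · refine ((hu3 k (θ l) (humono.monotone h)).2.2).trans
        (mul_le_mul_of_nonneg_left ?_ (by positivity))
      rw [mul_comm]
      exact hpow h
  -- A subsequence of `y` is dominated by a subsequence of the unit vectors, hence by the full
  -- basis, since spreading does not increase the norm.
  obtain ⟨T, hT⟩ := exists_clm_of_dominated (w := w) (p := p) (fun k => y (θ k)) hC (by
    intro a s
    have h1 := hdom (fun n => a (Function.invFun θ n)) (s.image θ)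
    have hinv : ∀ l, Function.invFun θ (θ l) = l := Function.leftInverse_invFun hθ.injective
    rw [Finset.sum_image hθ.injective.injOn, Finset.sum_image hθ.injective.injOn] at h1
    simp only [hinv] at h1
    exact h1.trans (mul_le_mul_of_nonneg_left (norm_sum_spread_le hθ a s) hC.le))
  obtain ⟨S, hS⟩ := exists_clm_subsequence (w := w) (p := p) hjθ (fun k => (d k)⁻¹)
    (inv_nonneg.2 hδ.le) (fun k => by
      rw [norm_inv]
      exact inv_anti₀ hδ (hd k).le)
  have hgeo : ∀ N, ∑ k ∈ Finset.range N, (1 / 2 : ℝ) ^ k ≤ 2 := fun N =>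
    sum_geometric_two_le N
  -- `S` divides the selected coordinates by the diagonal `d`, so the matrix of `S ∘L T` has
  -- diagonal `1`; the other entries are at most `1/8 * 2^(-k-l)`, with total at most `1/8 * 4 =
  -- 1/2`.
  have hD : ‖S ∘L T - ContinuousLinearMap.id 𝕜 (Garling 𝕜 w p)‖ ≤ 1 / 2 := by
    have h1 : ∀ l, ‖(S ∘L T - ContinuousLinearMap.id 𝕜 (Garling 𝕜 w p)) (garlingUnit 𝕜 w p l)‖
        ≤ 1 / 4 * (1 / 2) ^ l := by
      intro l
      refine norm_le_of_sum_apply_le _ fun N => ?_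
      have h2 : ∀ k ∈ Finset.range N, ‖toSeq ((S ∘L T - ContinuousLinearMap.id 𝕜 (Garling 𝕜 w p))
          (garlingUnit 𝕜 w p l)) k‖ ≤ 1 / 8 * (1 / 2) ^ l * (1 / 2) ^ k := by
        intro k _
        have h3 : toSeq ((S ∘L T - ContinuousLinearMap.id 𝕜 (Garling 𝕜 w p))
            (garlingUnit 𝕜 w p l)) k = (d k)⁻¹ * toSeq (y (θ l)) (j (θ k))
              - toSeq (garlingUnit 𝕜 w p l) k := by
          rw [← hS, ← hT]
          rfl
        rw [h3, toSeq_unitVector]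
        by_cases hkl : k = l
        · subst hkl
          rw [Pi.single_eq_same, inv_mul_cancel₀ (norm_pos_iff.1 (hδ.trans (hd k))), sub_self,
            norm_zero]
          positivity
        · rw [Pi.single_eq_of_ne hkl, sub_zero, norm_mul, norm_inv]
          have h4 : ‖d k‖⁻¹ ≤ δ⁻¹ := inv_anti₀ hδ (hd k).le
          refine (mul_le_mul h4 (hoff k l hkl) (norm_nonneg _) (by positivity)).trans (le_of_eq ?_)
          field_simp
      refine (Finset.sum_le_sum h2).trans ?_
      rw [← Finset.mul_sum]
      have := hgeo N
      have h5 : (0 : ℝ) < (1 / 2) ^ l := by positivity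
      nlinarith
    refine opNorm_le_of_sum_le _ fun N => (Finset.sum_le_sum fun l _ => h1 l).trans ?_
    rw [← Finset.mul_sum]
    linarith [hgeo N]
  obtain ⟨S', hS', -⟩ := exists_leftInverse_of_approx T S (by norm_num : (1 / 2 : ℝ) < 1) hD
  exact ⟨θ, hθ, closedComplemented_of_leftInverse hS' closedSpan_unit (c := fun _ => 1)
    (fun _ => one_ne_zero) fun i => by rw [hT, one_smul]; rfl⟩

/-- Sequences equivalent to the unit vectors have subsequences with complemented span. -/
theorem exists_complemented_subsequence {y : ℕ → Garling 𝕜 w p}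
    (h : AreEquivalent 𝕜 y (garlingUnit 𝕜 w p)) :
    ∃ k : ℕ → ℕ, StrictMono k ∧ (closedSpan 𝕜 (y ∘ k)).ClosedComplemented := by
  obtain ⟨C, hC, hdom⟩ := h.1.exists_norm_sum_le
  obtain ⟨C', hC', hdom'⟩ := h.2.exists_norm_sum_le
  have hlow : ∀ n, C'⁻¹ ≤ ‖y n‖ := fun n => by
    have := hdom' (fun _ => 1) {n}
    rw [Finset.sum_singleton, Finset.sum_singleton, one_smul, one_smul, norm_unit] at this
    rwa [inv_le_iff_one_le_mul₀' hC']
  have hy0 : ∀ i, Tendsto (fun n => toSeq (y n) i) atTop (𝓝 0) := fun i => by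
    refine tendsto_zero_of_dominated (w := w) (p := p) _ hC.le fun c s => ?_
    have : ∑ n ∈ s, c n • toSeq (y n) i = toSeq (∑ n ∈ s, c n • y n) i := by
      simp [map_sum, Finset.sum_apply]
    rw [this]
    exact (norm_apply_le _ i).trans (hdom c s)
  -- Dichotomy: in the first case a subsequence spans a complemented copy of `ℓ_p`, in the second a
  -- complemented copy of `g(w,p)`.
  by_cases hsmall : ∀ δ : ℝ, 0 < δ → ∃ᶠ n in atTop, ∀ i, ‖toSeq (y n) i‖ ≤ δ
  · exact exists_complemented_of_small (inv_pos.2 hC') hlow hsmall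
  · push Not at hsmall
    obtain ⟨δ, hδ, hlarge⟩ := hsmall
    exact exists_complemented_of_large hC hdom hy0 hδ (by simpa using hlarge)

end Garling

end GarlingSpaces

end

theorem mainTheorem1 {𝕜 : Type*} [RCLike 𝕜] (p : ℝ≥0) [Fact (1 ≤ p)] (w : Weight) :
    -- (i)
    (closedSpan 𝕜 (garlingUnit 𝕜 w p) = ⊤ ∧
      IsSchauderBasis 𝕜 (garlingUnit 𝕜 w p) ∧
      IsBoundedlyComplete 𝕜 (garlingUnit 𝕜 w p)) ∧
    -- (ii)
    (∀ y : ℕ → Garling 𝕜 w p, IsBasicSequence 𝕜 y → AreEquivalent 𝕜 y (garlingUnit 𝕜 w p) →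
      ∃ k : ℕ → ℕ, StrictMono k ∧ (closedSpan 𝕜 (y ∘ k)).ClosedComplemented) ∧
    -- (iii)
    ((1 < p → IsReflexive 𝕜 (Garling 𝕜 w p)) ∧ (p = 1 → ¬ IsReflexive 𝕜 (Garling 𝕜 w p))) ∧
    -- (iv)
    (¬ ∃ Y : Submodule 𝕜 (EllP 𝕜 p), Nonempty (Y ≃L[𝕜] Garling 𝕜 w p)) ∧
    -- (v)
    (∀ ε : ℝ, 0 < ε → ∀ Y : Submodule 𝕜 (Garling 𝕜 w p),
      IsClosed (Y : Set (Garling 𝕜 w p)) → ¬ FiniteDimensional 𝕜 Y →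
      ∃ Z : Submodule 𝕜 (Garling 𝕜 w p), Z ≤ Y ∧ IsClosed (Z : Set (Garling 𝕜 w p)) ∧
        IsIsomorphicWith 𝕜 Z (EllP 𝕜 p) (1 + ε) ∧ IsComplementedWith (1 + ε) Z) ∧
    -- (vi)
    (∃ (T : EllP 𝕜 p →L[𝕜] Lorentz 𝕜 w p) (S : Garling 𝕜 w p →L[𝕜] EllP 𝕜 p),
      S ∘L lorentzInclusion 𝕜 w p ∘L T = ContinuousLinearMap.id 𝕜 (EllP 𝕜 p)) := by
  refine ⟨⟨Garling.closedSpan_unit, Garling.isSchauderBasis_unit,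
    Garling.isBoundedlyComplete_unit⟩, fun y _ h => Garling.exists_complemented_subsequence h,
    ⟨Garling.isReflexive, ?_⟩, ?_, fun ε hε Y hYc hY => Garling.exists_complemented_ellP hε Y hYc hY,
    exists_factorization_lorentzInclusion 𝕜 w p⟩
  · rintro rfl
    exact Garling.not_isReflexive w
  · rintro ⟨Y, ⟨e⟩⟩
    exact Garling.not_isomorphic_subspace_ellP Y e
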